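/- Let $\mathfrak K$ be a field, let $\Gamma$ be a finite quiver without directed cycles, with vertex set $\Gamma_0$ and arrow set $\Gamma_1$, and let $\Lambda=\mathfrak K\Gamma/I$ with $I$ an admissible ideal of the path algebra. Paths are composed from right to left, $\mathrm s(\cdot)$ and $\mathrm t(\cdot)$ denote starting and end points, paths are identified with their classes in $\Lambda$, modules are finitely generated left modules, and $J$ is the Jacobson radical of $\Lambda$. A module is uniserial if it has exactly one composition series. Assume that $\Lambda$ is left multiserial, i.e. for each primitive idempotent $e$ of $\Lambda$ the left ideal $Je$ is a sum of uniserial $\Lambda$-modules. Let $U$ be a uniserial $\Lambda$-module of length $n$ with mast $p$; that is, $$p=\alpha_{n-1}\cdots\alpha_1:\ 1\xrightarrow{\alpha_1}2\xrightarrow{\alpha_2}\cdots\xrightarrow{\alpha_{n-1}}n$$ is a path in $\Gamma$ of length $n-1$ with $px\neq0$ for some $x\in U$. Put - $B=\{\beta\in\Gamma_1\mid \mathrm s(\beta)\in\{1,\dots,n-1\},\ \mathrm t(\beta)\notin\{1,\dots,n\}\}$, - $C=\{\gamma\in\Gamma_1\mid \mathrm s(\gamma)\notin\{1,\dots,n\},\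 \mathrm t(\gamma)\in\{2,\dots,n\}\}$, - $D=\{\delta\in\Gamma_1\mid \mathrm s(\delta),\mathrm t(\delta)\in\{1,\dots,n\},\ \delta\notin\{\alpha_1,\dots,\alpha_{n-1}\}\}$. Here an empty product of consecutive $\alpha$'s stands for $1$. Then the following statements are equivalent: (1) The embedding $JU\hookrightarrow U$ is irreducible; that is, it is neither a split monomorphism nor a split epimorphism, and whenever it factors as $JU\xrightarrow{\varphi}V\xrightarrow{\psi}U$ through a finitely generated $\Lambda$-module $V$, then $\varphi$ is a split monomorphism or $\psi$ is a split epimorphism. (2) $U$ is not simple, and both (a) and (b) hold: (a) $\beta\,\alpha_{\mathrm s(\beta)-1}\cdots\alpha_1\in Jp$ for every $\beta\in B$, and $\delta\,\alpha_{\mathrm s(\delta)-1}\cdots\alpha_1\in\mathfrak K\,\alpha_{\mathrm t(\delta)-1}\cdots\alpha_1$ for every $\delta\in D$. (b) There is a subset $R\subset J$ such that $\{rp+J^2p\mid r\in R\}$ is a $\mathfrak K$-basis of $Jp/J^2p$ and (i) for every $\gamma\in C$ there is $w\in pJ$ such that $r\,\alpha_{n-1}\cdots\alpha_{\mathrm t(\gamma)}\,\gamma=rw$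 for every $r\in R$; (ii) for every $\delta\in D$ and every $r\in R$, $r\,\alpha_{n-1}\cdots\alpha_{\mathrm t(\delta)}\,\delta\in\mathfrak K\,r\,\alpha_{n-1}\cdots\alpha_{\mathrm s(\delta)}$. -/

import Mathlib

open Quiver

noncomputable section

/-! ### Path algebras -/

/-- The underlying vector space of the path algebra `KΓ` of a quiver `Γ` with vertex type `Q`:
its basis is the set of all paths of `Γ` (including the trivial path at each vertex). -/
def PathAlgebra (K : Type*) [Field K] (Q : Type*) [Quiver Q] : Type _ :=
  (Σ a b : Q, Path a b) →₀ K

namespace PathAlgebra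

variable {K : Type*} [Field K] {Q : Type*} [Quiver Q]

instance : AddCommGroup (PathAlgebra K Q) :=
  inferInstanceAs (AddCommGroup ((Σ a b : Q, Path a b) →₀ K))

instance : Module K (PathAlgebra K Q) :=
  inferInstanceAs (Module K ((Σ a b : Q, Path a b) →₀ K))

/-- The basis element given by an element of the type of all paths. -/
def ofSigma (K : Type*) [Field K] {Q : Type*} [Quiver Q] (x : Σ a b : Q, Path a b) :
    PathAlgebra K Q :=
  Finsupp.single x 1

/-- The basis element of the path algebra given by the path `p`. -/
def of (K : Type*) [Field K] {Q : Type*} [Quiver Q] {a b : Q} (p : Path a b) :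
    PathAlgebra K Q :=
  ofSigma K ⟨a, b, p⟩

/-- Paths are composed from right to left: the product `x * y` of two paths is the path
"first `y`, then `x`" if `y` ends where `x` starts, and `0` otherwise. -/
def mulPath (K : Type*) [Field K] {Q : Type*} [Quiver Q] (x y : Σ a b : Q, Path a b) :
    PathAlgebra K Q :=
  open Classical in
  if h : x.1 = y.2.1 then of K (y.2.2.comp (x.2.2.cast h rfl)) else 0

/-- The linear map with prescribed values on the paths. -/
def lift {M : Type*} [AddCommGroup M] [Module K M] (f : (Σ a b : Q, Path a b) → M) :
    PathAlgebra K Q →ₗ[K] M :=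
  Finsupp.linearCombination K f

theorem lift_ofSigma {M : Type*} [AddCommGroup M] [Module K M] (f : (Σ a b : Q, Path a b) → M)
    (x : Σ a b : Q, Path a b) : lift f (ofSigma K x) = f x :=
  (Finsupp.linearCombination_single K 1 x).trans (one_smul K (f x))

/-- The bilinear extension of the product of paths. -/
def mulHom (K : Type*) [Field K] (Q : Type*) [Quiver Q] :
    PathAlgebra K Q →ₗ[K] PathAlgebra K Q →ₗ[K] PathAlgebra K Q :=
  lift fun x => lift fun y => mulPath K x y

instance : Mul (PathAlgebra K Q) := ⟨fun x y => mulHom K Q x y⟩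

/-- The unit is the sum of all trivial paths. -/
instance [Fintype Q] : One (PathAlgebra K Q) := ⟨∑ v : Q, of K (Path.nil : Path v v)⟩

theorem mul_def (x y : PathAlgebra K Q) : x * y = mulHom K Q x y := rfl

theorem one_def [Fintype Q] : (1 : PathAlgebra K Q) = ∑ v : Q, of K (Path.nil : Path v v) := rfl

theorem mulHom_ofSigma (x y : Σ a b : Q, Path a b) :
    mulHom K Q (ofSigma K x) (ofSigma K y) = mulPath K x y := by
  rw [mulHom, lift_ofSigma, lift_ofSigma]

theorem of_mul_of {a b c : Q} (p : Path a b) (q : Path b c) :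
    of K q * of K p = of K (p.comp q) := by
  rw [mul_def, of, of, mulHom_ofSigma, mulPath, dif_pos rfl]
  rfl

theorem of_mul_of_ne {a b c d : Q} (p : Path a b) (q : Path c d) (h : c ≠ b) :
    of K q * of K p = 0 := by
  rw [mul_def, of, of, mulHom_ofSigma, mulPath, dif_neg h]

theorem hom_ext {M : Type*} [AddCommGroup M] [Module K M] {f g : PathAlgebra K Q →ₗ[K] M}
    (h : ∀ (a b : Q) (p : Path a b), f (of K p) = g (of K p)) : f = g :=
  Finsupp.lhom_ext' fun x => LinearMap.ext_ring (h x.1 x.2.1 x.2.2)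

theorem mulHom_assoc (x y z : PathAlgebra K Q) :
    mulHom K Q (mulHom K Q x y) z = mulHom K Q x (mulHom K Q y z) := by
  have h1 : (mulHom K Q).flip z ∘ₗ (mulHom K Q).flip y = (mulHom K Q).flip (mulHom K Q y z) := by
    refine hom_ext fun a b p => ?_
    have h2 : (mulHom K Q).flip z ∘ₗ mulHom K Q (of K p) =
        mulHom K Q (of K p) ∘ₗ (mulHom K Q).flip z := by
      refine hom_ext fun c d q => ?_
      have h3 : mulHom K Q (mulHom K Q (of K p) (of K q)) =
          mulHom K Q (of K p) ∘ₗ mulHom K Q (of K q) := by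
        refine hom_ext fun e f r => ?_
        change (of K p * of K q) * of K r = of K p * (of K q * of K r)
        by_cases h1 : a = d
        · subst h1
          by_cases h2 : c = f
          · subst h2
            simp only [of_mul_of, Path.comp_assoc]
          · rw [of_mul_of, of_mul_of_ne _ _ h2, of_mul_of_ne _ _ h2]
            exact (map_zero (mulHom K Q (of K p))).symm
        · rw [of_mul_of_ne _ _ h1]
          by_cases h2 : c = f
          · subst h2
            rw [of_mul_of, of_mul_of_ne _ _ h1]
            exact LinearMap.congr_fun (map_zero (mulHom K Q)) (of K r)
          · rw [of_mul_of_ne _ _ h2]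
            refine (LinearMap.congr_fun (map_zero (mulHom K Q)) (of K r)).trans ?_
            exact (map_zero (mulHom K Q (of K p))).symm
      exact LinearMap.congr_fun h3 z
    exact LinearMap.congr_fun h2 y
  exact LinearMap.congr_fun h1 x

theorem one_mulHom [Fintype Q] (x : PathAlgebra K Q) : mulHom K Q 1 x = x := by
  classical
  suffices h : mulHom K Q 1 = LinearMap.id from LinearMap.congr_fun h x
  refine hom_ext fun a b p => ?_
  rw [one_def, map_sum, LinearMap.sum_apply, Finset.sum_eq_single b]
  · exact of_mul_of p Path.nil
  · intro c _ hc
    exact of_mul_of_ne _ _ hc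
  · intro h
    exact absurd (Finset.mem_univ b) h

theorem mulHom_one [Fintype Q] (x : PathAlgebra K Q) : mulHom K Q x 1 = x := by
  classical
  suffices h : (mulHom K Q).flip 1 = LinearMap.id from LinearMap.congr_fun h x
  refine hom_ext fun a b p => ?_
  rw [LinearMap.flip_apply, one_def, map_sum, Finset.sum_eq_single a]
  · exact (of_mul_of Path.nil p).trans (by rw [Path.nil_comp]; rfl)
  · intro c _ hc
    exact of_mul_of_ne _ _ hc.symm
  · intro h
    exact absurd (Finset.mem_univ a) h

instance [Fintype Q] : Ring (PathAlgebra K Q) :=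
  { (inferInstance : AddCommGroup (PathAlgebra K Q)),
    (inferInstance : Mul (PathAlgebra K Q)),
    (inferInstance : One (PathAlgebra K Q)) with
    left_distrib := fun x y z => map_add (mulHom K Q x) y z
    right_distrib := fun x y z => LinearMap.congr_fun (map_add (mulHom K Q) x y) z
    zero_mul := fun x => LinearMap.congr_fun (map_zero (mulHom K Q)) x
    mul_zero := fun x => map_zero (mulHom K Q x)
    mul_assoc := mulHom_assoc
    one_mul := one_mulHom
    mul_one := mulHom_one }

instance [Fintype Q] : Algebra K (PathAlgebra K Q) :=
  Algebra.ofModule (fun c x y => LinearMap.congr_fun (map_smul (mulHom K Q) c x) y)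
    (fun c x y => map_smul (mulHom K Q x) c y)

/-- The span of all paths of length at least `m`: the `m`-th power of the ideal of `KΓ` that is
generated by the arrows. -/
def arrowIdealPow (K : Type*) [Field K] (Q : Type*) [Quiver Q] (m : ℕ) :
    Submodule K (PathAlgebra K Q) :=
  Submodule.span K {x | ∃ (a b : Q) (p : Path a b), m ≤ p.length ∧ x = of K p}

end PathAlgebra

/-- The quiver has no directed cycles. -/
def QuiverIsAcyclic (Q : Type*) [Quiver Q] : Prop :=
  ∀ (a : Q) (p : Path a a), p.length = 0

/-- `π : KΓ → Λ` presents `Λ` as a quotient `KΓ/I` by an admissible ideal `I = ker π`, that is,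
`F ^ m ⊆ I ⊆ F ^ 2` for some `m ≥ 2`, where `F` is the ideal generated by the arrows. -/
def IsAdmissiblePresentation {K : Type*} [Field K] {Q : Type*} [Quiver Q] [Fintype Q]
    {Λ : Type*} [Ring Λ] [Algebra K Λ] (π : PathAlgebra K Q →ₐ[K] Λ) : Prop :=
  Function.Surjective π ∧
  LinearMap.ker π.toLinearMap ≤ PathAlgebra.arrowIdealPow K Q 2 ∧
  ∃ m : ℕ, 2 ≤ m ∧ PathAlgebra.arrowIdealPow K Q m ≤ LinearMap.ker π.toLinearMap

/-! ### Modules -/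

/-- A module is uniserial if it has exactly one composition series. -/
def IsUniserial (R : Type*) [Ring R] (M : Type*) [AddCommGroup M] [Module R M] : Prop :=
  ∃! s : CompositionSeries (Submodule R M), s.head = ⊥ ∧ s.last = ⊤

/-- The radical `JM` of a module `M`, where `J` is the Jacobson radical of the ring. -/
def radicalSubmodule (R : Type*) [Ring R] (M : Type*) [AddCommGroup M] [Module R M] :
    Submodule R M :=
  Ring.jacobson R • (⊤ : Submodule R M)

def IsSplitMonomorphism {R : Type*} [Ring R] {M N : Type*} [AddCommGroup M] [Module R M]
    [AddCommGroup N] [Module R N] (f : M →ₗ[R] N) : Prop :=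
  ∃ g : N →ₗ[R] M, g ∘ₗ f = LinearMap.id

def IsSplitEpimorphism {R : Type*} [Ring R] {M N : Type*} [AddCommGroup M] [Module R M]
    [AddCommGroup N] [Module R N] (f : M →ₗ[R] N) : Prop :=
  ∃ g : N →ₗ[R] M, f ∘ₗ g = LinearMap.id

/-- Irreducible maps in the category of finitely generated left modules. Every finitely generated
`R`-module is isomorphic to one in the universe of `R`, so that the middle terms may be taken
there. -/
def IsIrreducibleMap.{u, v, w} {R : Type u} [Ring R] {M : Type v} {N : Type w} [AddCommGroup M] [Module R M]
    [AddCommGroup N] [Module R N] (f : M →ₗ[R] N) : Prop :=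
  ¬ IsSplitMonomorphism f ∧ ¬ IsSplitEpimorphism f ∧
  ∀ (V : Type u) [AddCommGroup V] [Module R V] [Module.Finite R V]
    (φ : M →ₗ[R] V) (ψ : V →ₗ[R] N), ψ ∘ₗ φ = f →
      IsSplitMonomorphism φ ∨ IsSplitEpimorphism ψ

/-- `e` is a nonzero idempotent which is not the sum of two nonzero orthogonal idempotents. -/
def IsPrimitiveIdempotent {R : Type*} [Ring R] (e : R) : Prop :=
  IsIdempotentElem e ∧ e ≠ 0 ∧
  ∀ f g : R, IsIdempotentElem f → IsIdempotentElem g → f * g = 0 → g * f = 0 → e = f + g →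
    f = 0 ∨ g = 0

/-- For every primitive idempotent `e`, the left ideal `Je = {j * e | j ∈ J}` is a sum of uniserial
modules. -/
def IsLeftMultiserial (R : Type*) [Ring R] : Prop :=
  ∀ e : R, IsPrimitiveIdempotent e →
    ∃ S : Set (Submodule R R), (∀ N ∈ S, IsUniserial R N) ∧
      sSup S = (Ring.jacobson R).map (LinearMap.toSpanSingleton R R e)

/-! ### Masts and the combinatorial conditions -/

section Conditions

variable {K : Type*} [Field K] {Q : Type*} [Quiver Q] [Fintype Q]
  {Λ : Type*} [Ring Λ] [Algebra K Λ]

/-- The class in `Λ` of a path of the quiver. -/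
def pathClass (π : PathAlgebra K Q →ₐ[K] Λ) {a b : Q} (p : Path a b) : Λ :=
  π (PathAlgebra.of K p)

/-- `p` is a mast of `U`: its length is one less than the (finite) length of `U`, and `p` does not
annihilate `U`. -/
def IsMast (π : PathAlgebra K Q →ₐ[K] Λ) {a b : Q} (p : Path a b)
    (U : Type*) [AddCommGroup U] [Module Λ U] : Prop :=
  Module.length Λ U = p.length + 1 ∧ ∃ x : U, pathClass π p • x ≠ 0

/-- The arrow `δ` is one of the arrows of the path `p`. -/
def IsArrowOf {a b i j : Q} (δ : i ⟶ j) (p : Path a b) : Prop :=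
  ∃ (u : Path a i) (w : Path j b), p = (u.cons δ).comp w

/-- `L z = {l * z | l ∈ L}`, for a left ideal `L`, as a `K`-subspace of `Λ`. -/
def leftTimes (K : Type*) [Field K] {Λ : Type*} [Ring Λ] [Algebra K Λ] (L : Ideal Λ) (z : Λ) :
    Submodule K Λ :=
  (L.restrictScalars K).map (LinearMap.mulRight K z)

/-- `z L = {z * l | l ∈ L}`, as a `K`-subspace of `Λ`. -/
def timesLeft (K : Type*) [Field K] {Λ : Type*} [Ring Λ] [Algebra K Λ] (z : Λ) (L : Ideal Λ) :
    Submodule K Λ :=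
  (L.restrictScalars K).map (LinearMap.mulLeft K z)

/-- The condition on initial subpaths of `p`.
First part: for every arrow `β : i ⟶ j` with `i` a vertex of `p` other than its end point, and `j`
not a vertex of `p`, the path "`p` up to `i`, then `β`" lies in `Jp`.
Second part: for every arrow `δ : i ⟶ j` between vertices of `p` which is not an arrow of `p`, the
path "`p` up to `i`, then `δ`" is a scalar multiple of "`p` up to `j`".
When there are no directed cycles, the decompositions `p = u.comp w` are determined by the vertex
at which `p` is cut. -/
def ConditionA (π : PathAlgebra K Q →ₐ[K] Λ) {a b : Q} (p : Path a b) : Prop :=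
  (∀ (i j : Q) (β : i ⟶ j) (u : Path a i) (w : Path i b), p = u.comp w → i ≠ b →
    j ∉ p.vertices →
      pathClass π (u.cons β) ∈ leftTimes K (Ring.jacobson Λ) (pathClass π p)) ∧
  (∀ (i j : Q) (δ : i ⟶ j) (u : Path a i) (w : Path i b) (u' : Path a j) (w' : Path j b),
    p = u.comp w → p = u'.comp w' → ¬ IsArrowOf δ p →
      pathClass π (u.cons δ) ∈ Submodule.span K {pathClass π u'})

/-- For a subset `R` of `J`: the set `{rp + J²p | r ∈ R}` is a `K`-basis of `Jp/J²p`
(regarded as a subspace of `Λ/J²p`). -/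
def IsBasisModJSq (K : Type*) [Field K] {Λ : Type*} [Ring Λ] [Algebra K Λ]
    (R : Set Λ) (p : Λ) : Prop :=
  let q := (leftTimes K (Ring.jacobson Λ ^ 2) p).mkQ
  let S : Set (Λ ⧸ leftTimes K (Ring.jacobson Λ ^ 2) p) := {y | ∃ r ∈ R, y = q (r * p)}
  LinearIndepOn K id S ∧ Submodule.span K S = (leftTimes K (Ring.jacobson Λ) p).map q

/-- The condition on terminal subpaths of `p`. There is `R ⊆ J` such that `{rp + J²p | r ∈ R}` is a
`K`-basis of `Jp/J²p` and:
(i) for every arrow `γ : i ⟶ j` with `i` not a vertex of `p`, and `j` a vertex of `p` other than its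
starting point, there is `w ∈ pJ` such that `r * (γ, then p from j on) = r * w` for all `r ∈ R`;
(ii) for every arrow `δ : i ⟶ j` between vertices of `p` which is not an arrow of `p`, and every
`r ∈ R`, the element `r * (δ, then p from j on)` is a scalar multiple of `r * (p from i on)`. -/
def ConditionB (π : PathAlgebra K Q →ₐ[K] Λ) {a b : Q} (p : Path a b) : Prop :=
  ∃ R : Set Λ, R ⊆ (Ring.jacobson Λ : Set Λ) ∧ IsBasisModJSq K R (pathClass π p) ∧
    (∀ (i j : Q) (γ : i ⟶ j) (u' : Path a j) (w' : Path j b), p = u'.comp w' → j ≠ a →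
      i ∉ p.vertices →
        ∃ w ∈ timesLeft K (pathClass π p) (Ring.jacobson Λ),
          ∀ r ∈ R, r * pathClass π (γ.toPath.comp w') = r * w) ∧
    (∀ (i j : Q) (δ : i ⟶ j) (u : Path a i) (w : Path i b) (u' : Path a j) (w' : Path j b),
      p = u.comp w → p = u'.comp w' → ¬ IsArrowOf δ p →
        ∀ r ∈ R, r * pathClass π (δ.toPath.comp w') ∈ Submodule.span K {r * pathClass π w})

end Conditions

end

/-! Write `e_i` for the idempotent at `i`, `a` and `b` for the ends of `p`, `N = JU`. Without
directed cycles `e_i Λ e_i = K e_i`, `J` is the set of elements with zero diagonal, simple modules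
are one-dimensional, and a path is cut uniquely by each of its vertices. Hence a suitable `x ∈ e_a
U` makes the initial subpaths of `p`, applied to `x`, a `K`-basis of `U`; terminal subpaths, paired
with initial ones, give the dual coordinates. The combinatorial conditions then become two
ring-theoretic ones:

(A') if `l x = 0`, then `l e_a ∈ Λp`; (B') for some `R ⊆ J` with `Jp` generated by the `rp`, every
`τ ∈ e_b Λ` that kills `U` admits `w ∈ J` with `rτ = rpw` for all `r ∈ R`.

The conditions on arrows say that (initial parts) + `Jp` is stable under arrows on the left, and
that (terminal parts) + `pJ`, seen only through multiplication by `R`, is stable under arrows on the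
right. That gives (A') and (B'); conversely both conditions are instances of them.

Irreducibility implies (A') and (B'): by a pullback, each `V → U/N` lifts to `U` or is a factor of
`U → U/N`. The test module has generators `ε` and `ε_τ`, with `τ` running over finitely many
generators of the annihilator of `U` in `e_b Λ`, and the single relation `p ε = ∑ τ ε_τ`; it maps to
`U/N` by `ε ↦ x`. A lift would give `px = 0`, so there is a factorization, and comparing
coefficients in it gives (A') and (B') (`IsMastGenerator.exists_relations`).

(A') and (B') imply irreducibility (`IsMastGenerator.isSplitMonomorphism_or_isSplitEpimorphism`):
let `ψφ` be the inclusion and `ψ y₀ = x`. Either `y₀` can be corrected so that `Jp` sends it into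
the image of `φ`, and (A') yields a section of `ψ`; or a functional detects the obstruction. By (B')
that functional comes from a map `g : V → U`, because `U` is the space of functionals on `e_b Λ`
that vanish on the annihilator of `U`, and `ψ - g` is a retraction of `φ`. -/

namespace PathAlgebra

variable {K : Type*} [Field K] {Q : Type*} [Quiver Q]

theorem mem_of_forall_of_mem (G : Submodule K (PathAlgebra K Q))
    (h : ∀ (a b : Q) (p : Path a b), of K p ∈ G) (x : PathAlgebra K Q) : x ∈ G := by
  have h0 : G.mkQ = 0 := hom_ext fun a b p => by simpa using h a b p
  simpa using LinearMap.congr_fun h0 x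

end PathAlgebra

/-! ### Paths in a quiver without directed cycles. -/

namespace QuiverIsAcyclic

variable {Q : Type*} [Quiver Q]

theorem isEmpty_path (hQ : QuiverIsAcyclic Q) {i j : Q} (u : Path i j)
    (hij : i ≠ j) : IsEmpty (Path j i) := by
  refine ⟨fun v => hij (Path.eq_of_length_zero u ?_)⟩
  have h := hQ i (u.comp v)
  rw [Path.length_comp] at h
  omega

theorem ne_of_hom (hQ : QuiverIsAcyclic Q) {i j : Q} (ε : i ⟶ j) : i ≠ j := by
  rintro rfl
  simpa using hQ i ε.toPath

theorem nodup_vertices (hQ : QuiverIsAcyclic Q) {a b : Q} (p : Path a b) : p.vertices.Nodup := by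
  induction p with
  | nil => simp
  | cons p ε ih =>
    rename_i b c
    rw [Path.vertices_cons, List.concat_eq_append, List.nodup_append]
    refine ⟨ih, by simp, ?_⟩
    rintro x hx y hy rfl
    rw [List.mem_singleton] at hy
    subst hy
    obtain ⟨u, w, -⟩ := Path.exists_eq_comp_of_mem_vertices p hx
    simpa using hQ x (w.cons ε)

/-- Since vertices do not repeat, the position of `i` on the path is determined; so subpaths of `p`
may be indexed by vertices. -/
theorem comp_eq_comp (hQ : QuiverIsAcyclic Q) {a b i : Q} {u u' : Path a i} {w w' : Path i b}
    (h : u.comp w = u'.comp w') : u = u' ∧ w = w' := by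
  refine (Path.comp_inj' ?_).1 h
  have hn := hQ.nodup_vertices (u.comp w)
  have h1 := Path.vertices_comp_get_length_eq u w
  obtain ⟨hl, h2⟩ : ∃ hl, (u.comp w).vertices.get ⟨u'.length, hl⟩ = i := by
    rw [h]
    exact ⟨by simp, Path.vertices_comp_get_length_eq u' w'⟩
  exact congrArg Fin.val (hn.injective_get (h1.trans h2.symm))

end QuiverIsAcyclic

/-! ### Vertex idempotents, the Jacobson radical and finite dimensionality of `Λ`. -/

section QuotientOfPathAlgebra

variable {K : Type*} [Field K] {Q : Type*} [Quiver Q] [Fintype Q]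
  {Λ : Type*} [Ring Λ] [Algebra K Λ] (π : PathAlgebra K Q →ₐ[K] Λ)

/-- The class of the trivial path at the vertex `v`. -/
noncomputable def vertexIdem (v : Q) : Λ := pathClass π (Path.nil : Path v v)

theorem pathClass_mul_pathClass {a b c : Q} (p : Path a b) (q : Path b c) :
    pathClass π q * pathClass π p = pathClass π (p.comp q) := by
  rw [pathClass, pathClass, ← map_mul, PathAlgebra.of_mul_of, pathClass]

theorem pathClass_mul_pathClass_of_ne {a b c d : Q} (p : Path a b) (q : Path c d) (h : c ≠ b) :
    pathClass π q * pathClass π p = 0 := by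
  rw [pathClass, pathClass, ← map_mul, PathAlgebra.of_mul_of_ne _ _ h, map_zero]

theorem pathClass_cons {a b c : Q} (p : Path a b) (ε : b ⟶ c) :
    pathClass π (p.cons ε) = pathClass π ε.toPath * pathClass π p := by
  rw [pathClass_mul_pathClass]; rfl

theorem vertexIdem_mul_pathClass {a b : Q} (p : Path a b) :
    vertexIdem π b * pathClass π p = pathClass π p := by
  rw [vertexIdem, pathClass_mul_pathClass, Path.comp_nil]

theorem pathClass_mul_vertexIdem {a b : Q} (p : Path a b) :
    pathClass π p * vertexIdem π a = pathClass π p := by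
  rw [vertexIdem, pathClass_mul_pathClass, Path.nil_comp]

theorem vertexIdem_mul_pathClass_of_ne {a b c : Q} (p : Path a b) (h : c ≠ b) :
    vertexIdem π c * pathClass π p = 0 := pathClass_mul_pathClass_of_ne π _ _ h

theorem pathClass_mul_vertexIdem_of_ne {a b c : Q} (p : Path a b) (h : a ≠ c) :
    pathClass π p * vertexIdem π c = 0 := pathClass_mul_pathClass_of_ne π _ _ h

theorem vertexIdem_mul_self (v : Q) : vertexIdem π v * vertexIdem π v = vertexIdem π v :=
  vertexIdem_mul_pathClass π _

theorem vertexIdem_mul_of_ne {v w : Q} (h : v ≠ w) : vertexIdem π v * vertexIdem π w = 0 :=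
  vertexIdem_mul_pathClass_of_ne π _ h

theorem sum_vertexIdem : ∑ v : Q, vertexIdem π v = 1 := by
  rw [← map_one π, PathAlgebra.one_def, map_sum]; rfl

variable {π}

theorem mem_of_forall_pathClass_mem (hπ : Function.Surjective π) (G : Submodule K Λ)
    (h : ∀ (a b : Q) (p : Path a b), pathClass π p ∈ G) (l : Λ) : l ∈ G := by
  obtain ⟨x, rfl⟩ := hπ l
  exact PathAlgebra.mem_of_forall_of_mem (G.comap π.toLinearMap) h x

/-- Paths starting at `a` arise from the trivial one by adding arrows on the left, and all others
are killed by the idempotent at `a`. Stability under arrows thus suffices; the next lemma is the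
right-hand version. -/
theorem mul_vertexIdem_mem (hπ : Function.Surjective π) (G : Submodule K Λ) {a : Q}
    (ha : vertexIdem π a ∈ G)
    (h : ∀ (i j : Q) (ε : i ⟶ j) (g : Λ), g ∈ G → pathClass π ε.toPath * g ∈ G) (l : Λ) :
    l * vertexIdem π a ∈ G := by
  have key : ∀ (c d : Q) (q : Path c d), c = a → pathClass π q ∈ G := by
    intro c d q hc
    subst hc
    induction q with
    | nil => exact ha
    | cons q ε ih => rw [pathClass_cons]; exact h _ _ _ _ ih
  refine mem_of_forall_pathClass_mem hπ (G.comap (LinearMap.mulRight K (vertexIdem π a)))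
    (fun c d q => ?_) l
  rw [Submodule.mem_comap, LinearMap.mulRight_apply]
  by_cases hc : c = a
  · subst hc
    rw [pathClass_mul_vertexIdem]
    exact key _ _ q rfl
  · rw [pathClass_mul_vertexIdem_of_ne _ _ hc]
    exact zero_mem G

theorem vertexIdem_mul_mem (hπ : Function.Surjective π) (G : Submodule K Λ) {b : Q}
    (hb : vertexIdem π b ∈ G)
    (h : ∀ (i j : Q) (ε : i ⟶ j) (g : Λ), g ∈ G → g * pathClass π ε.toPath ∈ G) (l : Λ) :
    vertexIdem π b * l ∈ G := by
  have key : ∀ (c d : Q) (q : Path c d) (g : Λ), g ∈ G → g * vertexIdem π d = g →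
      g * pathClass π q ∈ G := by
    intro c d q
    induction q with
    | nil => intro g hg hd; exact (hd.symm ▸ hg : g * vertexIdem π c ∈ G)
    | cons q ε ih =>
      intro g hg hd
      rw [pathClass_cons, ← mul_assoc]
      exact ih _ (h _ _ _ _ hg) (by rw [mul_assoc, pathClass_mul_vertexIdem])
  refine mem_of_forall_pathClass_mem hπ (G.comap (LinearMap.mulLeft K (vertexIdem π b)))
    (fun c d q => ?_) l
  rw [Submodule.mem_comap, LinearMap.mulLeft_apply]
  by_cases hd : b = d
  · subst hd
    exact key _ _ q _ hb (vertexIdem_mul_self π b)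
  · rw [vertexIdem_mul_pathClass_of_ne _ _ hd]
    exact zero_mem G

/-- The only path from `i` to `i` is the trivial one. -/
theorem vertexIdem_mul_mul_vertexIdem_eq_smul (hQ : QuiverIsAcyclic Q)
    (hπ : Function.Surjective π) (i : Q) (l : Λ) :
    ∃ c : K, vertexIdem π i * l * vertexIdem π i = c • vertexIdem π i := by
  have h := mem_of_forall_pathClass_mem hπ ((Submodule.span K {vertexIdem π i}).comap
    (LinearMap.mulRight K (vertexIdem π i) ∘ₗ LinearMap.mulLeft K (vertexIdem π i))) ?_ l
  · obtain ⟨c, hc⟩ := Submodule.mem_span_singleton.1 h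
    exact ⟨c, hc.symm⟩
  · intro a b q
    simp only [Submodule.mem_comap, LinearMap.comp_apply, LinearMap.mulRight_apply,
      LinearMap.mulLeft_apply]
    by_cases hb : i = b
    · subst hb
      by_cases ha : a = i
      · subst ha
        rw [Path.eq_nil_of_length_zero q (hQ _ q)]
        change vertexIdem π a * vertexIdem π a * vertexIdem π a ∈ _
        rw [vertexIdem_mul_self, vertexIdem_mul_self]
        exact Submodule.mem_span_singleton_self _
      · rw [mul_assoc, pathClass_mul_vertexIdem_of_ne _ _ ha, mul_zero]
        exact zero_mem _
    · rw [vertexIdem_mul_pathClass_of_ne _ _ hb, zero_mul]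
      exact zero_mem _

theorem vertexIdem_mul_mul_vertexIdem_eq_zero_of_isEmpty
    (hπ : Function.Surjective π) {i j : Q} (h : IsEmpty (Path j i)) (l : Λ) :
    vertexIdem π i * l * vertexIdem π j = 0 := by
  refine mem_of_forall_pathClass_mem hπ (LinearMap.ker
    (LinearMap.mulRight K (vertexIdem π j) ∘ₗ LinearMap.mulLeft K (vertexIdem π i))) ?_ l
  intro a b q
  simp only [LinearMap.mem_ker, LinearMap.comp_apply, LinearMap.mulRight_apply,
      LinearMap.mulLeft_apply]
  by_cases hb : i = b
  · subst hb
    by_cases ha : a = j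
    · subst ha
      exact h.elim q
    · rw [mul_assoc, pathClass_mul_vertexIdem_of_ne _ _ ha, mul_zero]
  · rw [vertexIdem_mul_pathClass_of_ne _ _ hb, zero_mul]

theorem vertexIdem_mul_mul_vertexIdem_eq_zero (hQ : QuiverIsAcyclic Q)
    (hπ : Function.Surjective π) {i j : Q} (u : Path i j) (hij : i ≠ j) (l : Λ) :
    vertexIdem π i * l * vertexIdem π j = 0 :=
  vertexIdem_mul_mul_vertexIdem_eq_zero_of_isEmpty hπ (hQ.isEmpty_path u hij) l

theorem sum_vertexIdem_mul (l : Λ) : ∑ v : Q, vertexIdem π v * l = l := by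
  rw [← Finset.sum_mul, sum_vertexIdem, one_mul]

theorem sum_mul_vertexIdem (l : Λ) : ∑ v : Q, l * vertexIdem π v = l := by
  rw [← Finset.mul_sum, sum_vertexIdem, mul_one]

theorem mem_jacobson_iff_exists_mul_eq_one {R : Type*} [Ring R] {x : R} :
    x ∈ Ring.jacobson R ↔ ∀ y, ∃ z, z * (1 + y * x) = 1 := by
  rw [← Ideal.jacobson_bot, Ideal.mem_jacobson_iff]
  simp only [Ideal.mem_bot, sub_eq_zero, mul_add, mul_one, ← mul_assoc, add_comm]

/-- Paths cannot run both from `i` to `j` and from `j` to `i`: either the element is zero, or each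
left multiple `y * x` of it squares to zero, so that `1 + y * x` has the inverse `1 - y * x`. -/
theorem vertexIdem_mul_mul_vertexIdem_mem_jacobson (hQ : QuiverIsAcyclic Q)
    (hπ : Function.Surjective π) {i j : Q} (hij : i ≠ j) (l : Λ) :
    vertexIdem π i * l * vertexIdem π j ∈ Ring.jacobson Λ := by
  by_cases h : IsEmpty (Path j i)
  · rw [vertexIdem_mul_mul_vertexIdem_eq_zero_of_isEmpty hπ h]
    exact zero_mem _
  · obtain ⟨u⟩ := not_isEmpty_iff.1 h
    rw [mem_jacobson_iff_exists_mul_eq_one]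
    intro y
    set x := vertexIdem π i * l * vertexIdem π j with hx
    have h0 : y * x * (y * x) = 0 := by
      have : y * x * (y * x) = y * (vertexIdem π i * l) *
          (vertexIdem π j * y * vertexIdem π i) * (l * vertexIdem π j) := by
        rw [hx]; noncomm_ring
      rw [this, vertexIdem_mul_mul_vertexIdem_eq_zero hQ hπ u hij.symm, mul_zero, zero_mul]
    refine ⟨1 - y * x, ?_⟩
    rw [sub_mul, one_mul, mul_add, mul_one, h0]
    abel

theorem mem_jacobson_iff_vertexIdem (hQ : QuiverIsAcyclic Q) (hπ : Function.Surjective π) {l : Λ} :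
    l ∈ Ring.jacobson Λ ↔ ∀ i, vertexIdem π i * l * vertexIdem π i = 0 := by
  constructor
  · intro hl i
    have h1 : vertexIdem π i * l * vertexIdem π i ∈ Ring.jacobson Λ :=
      Ideal.mul_mem_right _ _ (Ideal.mul_mem_left _ _ hl)
    obtain ⟨c, hc⟩ := vertexIdem_mul_mul_vertexIdem_eq_smul hQ hπ i l
    rw [hc] at h1 ⊢
    by_cases h0 : c = 0
    · rw [h0, zero_smul]
    · obtain ⟨z, hz⟩ := mem_jacobson_iff_exists_mul_eq_one.1 h1 (-algebraMap K Λ c⁻¹)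
      have h2 : -algebraMap K Λ c⁻¹ * c • vertexIdem π i = -vertexIdem π i := by
        rw [neg_mul, ← Algebra.smul_def, smul_smul, inv_mul_cancel₀ h0, one_smul]
      rw [h2] at hz
      have h3 : vertexIdem π i = 0 := by
        rw [← one_mul (vertexIdem π i), ← hz, mul_assoc, add_mul, neg_mul, one_mul,
          vertexIdem_mul_self, add_neg_cancel, mul_zero]
      rw [h3, smul_zero]
  · intro h
    rw [← sum_vertexIdem_mul (π := π) l]
    refine sum_mem fun i _ => ?_
    rw [← sum_mul_vertexIdem (π := π) (vertexIdem π i * l)]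
    refine sum_mem fun j _ => ?_
    by_cases hij : i = j
    · subst hij
      rw [h]
      exact zero_mem _
    · exact vertexIdem_mul_mul_vertexIdem_mem_jacobson hQ hπ hij l

theorem pathClass_mem_jacobson (hQ : QuiverIsAcyclic Q) (hπ : Function.Surjective π) {a b : Q}
    (p : Path a b) (h : a ≠ b) : pathClass π p ∈ Ring.jacobson Λ := by
  have := vertexIdem_mul_mul_vertexIdem_mem_jacobson hQ hπ h.symm (pathClass π p)
  rwa [vertexIdem_mul_pathClass, pathClass_mul_vertexIdem] at this

theorem IsAdmissiblePresentation.moduleFinite [∀ a b : Q, Finite (a ⟶ b)]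
    (hπ : IsAdmissiblePresentation π) : Module.Finite K Λ := by
  obtain ⟨hs, -, m, -, hm⟩ := hπ
  let f : Q ⊕ (Σ i j : Q, (i ⟶ j)) → Λ :=
    Sum.elim (vertexIdem π) (fun x => pathClass π x.2.2.toPath)
  let A : Submodule K Λ := Submodule.span K (Set.range f)
  have hA : A.FG := Submodule.fg_span (Set.finite_range f)
  have hA0 : ∀ v, vertexIdem π v ∈ A := fun v => Submodule.subset_span ⟨Sum.inl v, rfl⟩
  have hA1 : ∀ (i j : Q) (ε : i ⟶ j), pathClass π ε.toPath ∈ A :=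
    fun i j ε => Submodule.subset_span ⟨Sum.inr ⟨i, j, ε⟩, rfl⟩
  have h1 : 1 ≤ A := by
    rw [Submodule.one_le, ← sum_vertexIdem π]
    exact sum_mem fun v _ => hA0 v
  have hq : ∀ (a b : Q) (q : Path a b), pathClass π q ∈ A ^ (q.length + 1) := by
    intro a b q
    induction q with
    | nil => rw [Path.length_nil, zero_add, pow_one]; exact hA0 _
    | cons q ε ih =>
      rw [pathClass_cons, Path.length_cons, pow_succ']
      exact Submodule.mul_mem_mul (hA1 _ _ _) ih
  -- Paths of length at least `m` vanish in `Λ`; shorter ones lie in `A ^ m` because `1 ∈ A`.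
  have htop : A ^ m = ⊤ := by
    refine eq_top_iff.2 fun l _ => mem_of_forall_pathClass_mem hs _ (fun a b q => ?_) l
    by_cases hqm : m ≤ q.length
    · have : pathClass π q = 0 := hm (Submodule.subset_span ⟨a, b, q, hqm, rfl⟩)
      rw [this]
      exact zero_mem _
    · exact pow_le_pow_right' h1 (by omega) (hq a b q)
  exact ⟨htop ▸ hA.pow m⟩

end QuotientOfPathAlgebra

/-! ### Initial and terminal parts of the mast. -/

section Subpaths

variable {K : Type*} [Field K] {Q : Type*} [Quiver Q] [Fintype Q]
  {Λ : Type*} [Ring Λ] [Algebra K Λ] (π : PathAlgebra K Q →ₐ[K] Λ) {a b : Q} (p : Path a b)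

theorem mem_vertices_iff_exists_comp {Q : Type*} [Quiver Q] {a b : Q} {p : Path a b} {i : Q} :
    i ∈ p.vertices ↔ ∃ (u : Path a i) (w : Path i b), p = u.comp w := by
  refine ⟨fun h => Path.exists_eq_comp_of_mem_vertices p h, ?_⟩
  rintro ⟨u, w, rfl⟩
  rw [Path.vertices_comp, List.mem_append]
  exact Or.inr (Path.start_mem_vertices w)

open Classical in
/-- The class of the initial subpath of `p` that ends at `i`, or `0` if `i` is not on `p`. -/
noncomputable def initialPart (i : Q) : Λ :=
  if h : ∃ (u : Path a i) (w : Path i b), p = u.comp w then pathClass π h.choose else 0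

open Classical in
/-- The class of the terminal subpath of `p` that starts at `i`, or `0` if `i` is not on `p`. -/
noncomputable def terminalPart (i : Q) : Λ :=
  if h : ∃ (w : Path i b) (u : Path a i), p = u.comp w then pathClass π h.choose else 0

variable {π p}

theorem initialPart_eq (hQ : QuiverIsAcyclic Q) {i : Q} {u : Path a i} {w : Path i b}
    (h : p = u.comp w) : initialPart π p i = pathClass π u := by
  have h' : ∃ (u : Path a i) (w : Path i b), p = u.comp w := ⟨u, w, h⟩
  rw [initialPart, dif_pos h']
  obtain ⟨w', hw'⟩ := h'.choose_spec
  exact congrArg _ (hQ.comp_eq_comp (hw'.symm.trans h)).1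

theorem terminalPart_eq (hQ : QuiverIsAcyclic Q) {i : Q} {u : Path a i} {w : Path i b}
    (h : p = u.comp w) : terminalPart π p i = pathClass π w := by
  have h' : ∃ (w : Path i b) (u : Path a i), p = u.comp w := ⟨w, u, h⟩
  rw [terminalPart, dif_pos h']
  obtain ⟨u', hu'⟩ := h'.choose_spec
  exact congrArg _ (hQ.comp_eq_comp (hu'.symm.trans h)).2

theorem initialPart_of_notMem {i : Q} (h : i ∉ p.vertices) : initialPart π p i = 0 :=
  dif_neg fun h' => h (mem_vertices_iff_exists_comp.2 h')

theorem terminalPart_of_notMem {i : Q} (h : i ∉ p.vertices) : terminalPart π p i = 0 :=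
  dif_neg fun ⟨w, u, h'⟩ => h (mem_vertices_iff_exists_comp.2 ⟨u, w, h'⟩)

theorem initialPart_start (hQ : QuiverIsAcyclic Q) : initialPart π p a = vertexIdem π a :=
  initialPart_eq hQ (u := Path.nil) (w := p) (Path.nil_comp p).symm

theorem initialPart_end (hQ : QuiverIsAcyclic Q) : initialPart π p b = pathClass π p :=
  initialPart_eq hQ (u := p) (w := Path.nil) (Path.comp_nil p).symm

theorem terminalPart_start (hQ : QuiverIsAcyclic Q) : terminalPart π p a = pathClass π p :=
  terminalPart_eq hQ (u := Path.nil) (w := p) (Path.nil_comp p).symm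

theorem terminalPart_end (hQ : QuiverIsAcyclic Q) : terminalPart π p b = vertexIdem π b :=
  terminalPart_eq hQ (u := p) (w := Path.nil) (Path.comp_nil p).symm

theorem vertexIdem_mul_initialPart (hQ : QuiverIsAcyclic Q) (i : Q) :
    vertexIdem π i * initialPart π p i = initialPart π p i := by
  by_cases h : i ∈ p.vertices
  · obtain ⟨u, w, h⟩ := mem_vertices_iff_exists_comp.1 h
    rw [initialPart_eq hQ h, vertexIdem_mul_pathClass]
  · rw [initialPart_of_notMem h, mul_zero]

theorem initialPart_mul_vertexIdem (hQ : QuiverIsAcyclic Q) (i : Q) :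
    initialPart π p i * vertexIdem π a = initialPart π p i := by
  by_cases h : i ∈ p.vertices
  · obtain ⟨u, w, h⟩ := mem_vertices_iff_exists_comp.1 h
    rw [initialPart_eq hQ h, pathClass_mul_vertexIdem]
  · rw [initialPart_of_notMem h, zero_mul]

theorem vertexIdem_mul_terminalPart (hQ : QuiverIsAcyclic Q) (i : Q) :
    vertexIdem π b * terminalPart π p i = terminalPart π p i := by
  by_cases h : i ∈ p.vertices
  · obtain ⟨u, w, h⟩ := mem_vertices_iff_exists_comp.1 h
    rw [terminalPart_eq hQ h, vertexIdem_mul_pathClass]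
  · rw [terminalPart_of_notMem h, mul_zero]

theorem terminalPart_mul_vertexIdem (hQ : QuiverIsAcyclic Q) (i : Q) :
    terminalPart π p i * vertexIdem π i = terminalPart π p i := by
  by_cases h : i ∈ p.vertices
  · obtain ⟨u, w, h⟩ := mem_vertices_iff_exists_comp.1 h
    rw [terminalPart_eq hQ h, pathClass_mul_vertexIdem]
  · rw [terminalPart_of_notMem h, zero_mul]

/-- With the next lemma: terminal and initial parts are dual families, pairing to `p` or `0`. All
coefficient extractions below rest on this. -/
theorem terminalPart_mul_initialPart (hQ : QuiverIsAcyclic Q) {i : Q} (h : i ∈ p.vertices) :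
    terminalPart π p i * initialPart π p i = pathClass π p := by
  obtain ⟨u, w, h⟩ := mem_vertices_iff_exists_comp.1 h
  rw [initialPart_eq hQ h, terminalPart_eq hQ h, pathClass_mul_pathClass, ← h]

theorem terminalPart_mul_initialPart_of_ne (hQ : QuiverIsAcyclic Q) {i j : Q} (h : i ≠ j) :
    terminalPart π p i * initialPart π p j = 0 := by
  rw [← terminalPart_mul_vertexIdem hQ, ← vertexIdem_mul_initialPart hQ, mul_assoc,
    ← mul_assoc (vertexIdem π i), vertexIdem_mul_of_ne π h, zero_mul, mul_zero]

theorem vertexIdem_mul_mul_vertexIdem_eq_zero_of_mem_jacobson (hQ : QuiverIsAcyclic Q)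
    (hπ : Function.Surjective π) {i j : Q} (u : Path i j) {l : Λ} (hl : l ∈ Ring.jacobson Λ) :
    vertexIdem π i * l * vertexIdem π j = 0 := by
  by_cases hi : i = j
  · subst hi
    exact (mem_jacobson_iff_vertexIdem hQ hπ).1 hl i
  · exact vertexIdem_mul_mul_vertexIdem_eq_zero hQ hπ u hi l

/-- No nontrivial path returns from a vertex of `p` to its start, and `J` has no diagonal part. -/
theorem vertexIdem_start_mul_mul_initialPart (hQ : QuiverIsAcyclic Q)
    (hπ : Function.Surjective π) {l : Λ} (hl : l ∈ Ring.jacobson Λ) (i : Q) :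
    vertexIdem π a * l * initialPart π p i = 0 := by
  by_cases h : i ∈ p.vertices
  · obtain ⟨u, w, h⟩ := mem_vertices_iff_exists_comp.1 h
    rw [← vertexIdem_mul_initialPart hQ, ← mul_assoc,
      vertexIdem_mul_mul_vertexIdem_eq_zero_of_mem_jacobson hQ hπ u hl, zero_mul]
  · rw [initialPart_of_notMem h, mul_zero]

theorem pathClass_mul_mul_initialPart (hQ : QuiverIsAcyclic Q)
    (hπ : Function.Surjective π) {l : Λ} (hl : l ∈ Ring.jacobson Λ) (i : Q) :
    pathClass π p * l * initialPart π p i = 0 := by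
  rw [← pathClass_mul_vertexIdem, mul_assoc (pathClass π p), mul_assoc (pathClass π p),
    vertexIdem_start_mul_mul_initialPart hQ hπ hl, mul_zero]

end Subpaths

/-! ### Length equals `K`-dimension. -/

section Dimension

variable {K : Type*} [Field K] {Q : Type*} [Quiver Q] [Fintype Q]
  {Λ : Type*} [Ring Λ] [Algebra K Λ] {π : PathAlgebra K Q →ₐ[K] Λ}

theorem sum_vertexIdem_smul (π : PathAlgebra K Q →ₐ[K] Λ) {M : Type*} [AddCommGroup M]
    [Module Λ M] (x : M) : ∑ v : Q, vertexIdem π v • x = x := by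
  rw [← Finset.sum_smul, sum_vertexIdem, one_smul]

/-- `J` kills `S`, and modulo `J` an element `l` acts on `y = e_v y` through `e_v l e_v`, that is,
by a scalar. -/
theorem finrank_eq_one_of_isSimpleModule (hQ : QuiverIsAcyclic Q) (hπ : Function.Surjective π)
    {S : Type*} [AddCommGroup S] [Module K S] [Module Λ S] [IsScalarTower K Λ S]
    [IsSimpleModule Λ S] : Module.finrank K S = 1 := by
  have : Nontrivial S := IsSimpleModule.nontrivial Λ S
  obtain ⟨x, hx⟩ := exists_ne (0 : S)
  obtain ⟨v, hv⟩ : ∃ v : Q, vertexIdem π v • x ≠ 0 := by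
    by_contra! h
    exact hx (by rw [← sum_vertexIdem_smul π x, Finset.sum_eq_zero fun v _ => h v])
  set y := vertexIdem π v • x with hy
  have hJ : ∀ l ∈ Ring.jacobson Λ, l • y = 0 := by
    intro l hl
    have h1 : Module.jacobson Λ S = ⊥ := IsSemisimpleModule.jacobson_eq_bot Λ S
    have h2 := Ring.jacobson_smul_top_le Λ S (Submodule.smul_mem_smul hl (Submodule.mem_top (x := y)))
    rwa [h1, Submodule.mem_bot] at h2
  refine finrank_eq_one y hv fun z => ?_
  obtain ⟨l, rfl⟩ := IsSimpleModule.toSpanSingleton_surjective Λ hv z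
  obtain ⟨c, hc⟩ := vertexIdem_mul_mul_vertexIdem_eq_smul hQ hπ v l
  refine ⟨c, ?_⟩
  rw [LinearMap.toSpanSingleton_apply]
  have hey : vertexIdem π v • y = y := by rw [hy, ← mul_smul, vertexIdem_mul_self]
  have h1 : vertexIdem π v • l • y = c • y := by
    calc vertexIdem π v • l • y = (vertexIdem π v * l * vertexIdem π v) • y := by
          rw [mul_smul, mul_smul, hey]
      _ = c • y := by rw [hc, smul_assoc, hey]
  rw [← h1]
  refine Eq.trans (Eq.symm ?_) (sum_vertexIdem_smul π (l • y))
  refine Finset.sum_eq_single v (fun w _ hw => ?_) (fun h => absurd (Finset.mem_univ v) h)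
  rw [← hey, ← mul_smul, ← mul_smul]
  exact hJ _ (vertexIdem_mul_mul_vertexIdem_mem_jacobson hQ hπ hw l)

theorem length_eq_finrank_of_isFiniteLength (hQ : QuiverIsAcyclic Q)
    (hπ : Function.Surjective π) {M : Type*} [AddCommGroup M] [Module Λ M]
    (h : IsFiniteLength Λ M) : ∀ [Module K M] [IsScalarTower K Λ M],
      Module.Finite K M ∧ Module.length Λ M = Module.finrank K M := by
  induction h with
  | of_subsingleton =>
    intro _ _
    exact ⟨inferInstance, by rw [Module.length_eq_zero, Module.finrank_zero_of_subsingleton,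
      Nat.cast_zero]⟩
  | @of_simple_quotient M _ _ N _ _ ih =>
    intro _ _
    obtain ⟨h1, h2⟩ := ih
    have h3 : Module.finrank K (M ⧸ N) = 1 := finrank_eq_one_of_isSimpleModule hQ hπ
    have h4 : Module.Finite K (M ⧸ N) := Module.finite_of_finrank_eq_succ h3
    have h1' : Module.Finite K (N.restrictScalars K) := h1
    have h4' : Module.Finite K (M ⧸ N.restrictScalars K) := h4
    have h5 : Module.Finite K M := Module.Finite.of_submodule_quotient (N.restrictScalars K)
    refine ⟨h5, ?_⟩
    have h6 := (N.restrictScalars K).finrank_quotient_add_finrank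
    have h3' : Module.finrank K (M ⧸ N.restrictScalars K) = 1 := h3
    have h7 := Module.length_eq_add_of_exact N.subtype N.mkQ N.subtype_injective
      N.mkQ_surjective (LinearMap.exact_subtype_mkQ N)
    rw [h7, Module.length_eq_one Λ (M ⧸ N), h2, ← h6, h3', add_comm]
    rfl

end Dimension

/-! ### The basis of `U` given by the mast. -/

section Mast

variable {K : Type*} [Field K] {Q : Type*} [Quiver Q] [Fintype Q]
  {Λ : Type*} [Ring Λ] [Algebra K Λ] (π : PathAlgebra K Q →ₐ[K] Λ) {a b : Q} (p : Path a b)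
  {U : Type*} [AddCommGroup U] [Module K U] [Module Λ U] [IsScalarTower K Λ U]

/-- `x` is a top element of a module with mast `p`: it belongs to the starting point of `p`, is not
annihilated by `p`, and its multiples by initial subpaths of `p` span the module over `K`. -/
structure IsMastGenerator (x : U) : Prop where
  smul_ne_zero : pathClass π p • x ≠ 0
  vertexIdem_smul : vertexIdem π a • x = x
  exists_eq_sum : ∀ u : U, ∃ c : Q → K, u = ∑ i, c i • initialPart π p i • x

variable {π p}

theorem IsMast.exists_isMastGenerator (hQ : QuiverIsAcyclic Q) (hπ : Function.Surjective π)
    (h : IsMast π p U) : ∃ x : U, IsMastGenerator π p x := by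
  classical
  obtain ⟨hlen, x, hx⟩ := h
  have hfl : IsFiniteLength Λ U := Module.length_ne_top_iff.1 (by
    rw [hlen]; exact_mod_cast ENat.natCast_ne_top (p.length + 1))
  obtain ⟨hfin, hdim⟩ := length_eq_finrank_of_isFiniteLength (K := K) hQ hπ hfl
  have hx' : pathClass π p • vertexIdem π a • x ≠ 0 := by
    rwa [← mul_smul, pathClass_mul_vertexIdem]
  generalize hy : vertexIdem π a • x = y at hx'
  refine ⟨y, hx', by rw [← hy, ← mul_smul, vertexIdem_mul_self], ?_⟩
  let v : {i // i ∈ p.vertices.toFinset} → U := fun i => initialPart π p i.1 • y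
  have hv : LinearIndependent K v := by
    rw [Fintype.linearIndependent_iff]
    intro g hg i
    have h1 := congrArg (terminalPart π p i.1 • ·) hg
    simp only [smul_zero, Finset.smul_sum] at h1
    rw [Finset.sum_eq_single i] at h1
    · rw [smul_comm, ← mul_smul,
        terminalPart_mul_initialPart hQ (List.mem_toFinset.1 i.2)] at h1
      exact (smul_eq_zero.1 h1).resolve_right hx'
    · intro j _ hj
      rw [smul_comm, ← mul_smul,
        terminalPart_mul_initialPart_of_ne hQ (fun h => hj (Subtype.ext h.symm)), zero_smul,
        smul_zero]
    · exact fun h => absurd (Finset.mem_univ i) h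
  -- `p` has `p.length + 1` distinct vertices, which is the length of `U`, hence its dimension;
  -- independence therefore gives spanning.
  have hcard : Fintype.card {i // i ∈ p.vertices.toFinset} = Module.finrank K U := by
    rw [Fintype.card_coe, List.toFinset_card_of_nodup (hQ.nodup_vertices p), Path.vertices_length]
    rw [hlen] at hdim
    exact_mod_cast hdim
  have hspan := hv.span_eq_top_of_card_eq_finrank' hcard
  intro u
  have hu : u ∈ Submodule.span K (Set.range fun i => initialPart π p i • y) := by
    refine Submodule.span_mono ?_ (hspan ▸ Submodule.mem_top : u ∈ Submodule.span K (Set.range v))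
    rintro _ ⟨i, rfl⟩
    exact ⟨i.1, rfl⟩
  obtain ⟨c, hc⟩ := (Submodule.mem_span_range_iff_exists_fun K).1 hu
  exact ⟨c, hc.symm⟩

theorem mem_radicalSubmodule {R M : Type*} [Ring R] [AddCommGroup M] [Module R M] {r : R}
    (hr : r ∈ Ring.jacobson R) (m : M) : r • m ∈ radicalSubmodule R M :=
  Submodule.smul_mem_smul hr Submodule.mem_top

theorem terminalPart_smul_sum (hQ : QuiverIsAcyclic Q) {i : Q} (hi : i ∈ p.vertices) (c : Q → K) (x : U) :
    terminalPart π p i • ∑ j, c j • initialPart π p j • x = c i • pathClass π p • x := by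
  rw [Finset.smul_sum, Finset.sum_eq_single i]
  · rw [smul_comm, ← mul_smul, terminalPart_mul_initialPart hQ hi]
  · intro j _ hj
    rw [smul_comm, ← mul_smul, terminalPart_mul_initialPart_of_ne hQ hj.symm, zero_smul,
      smul_zero]
  · exact fun h => absurd (Finset.mem_univ i) h

namespace IsMastGenerator

variable {x : U} (h : IsMastGenerator π p x)
include h

theorem exists_smul_eq (u : U) : ∃ l : Λ, l • x = u := by
  obtain ⟨c, rfl⟩ := h.exists_eq_sum u
  exact ⟨∑ i, c i • initialPart π p i, by simp only [Finset.sum_smul, smul_assoc]⟩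

theorem eq_zero_of_sum_eq_zero (hQ : QuiverIsAcyclic Q) {c : Q → K}
    (hc : ∑ j, c j • initialPart π p j • x = 0) {i : Q} (hi : i ∈ p.vertices) : c i = 0 := by
  have h1 := terminalPart_smul_sum (π := π) hQ hi c x
  rw [hc, smul_zero] at h1
  exact (smul_eq_zero.1 h1.symm).resolve_right h.smul_ne_zero

/-- Terminal parts read off the coordinates of `u`, so they separate points of `U`. -/
theorem eq_zero_of_terminalPart_smul (hQ : QuiverIsAcyclic Q) {u : U}
    (hu : ∀ i, terminalPart π p i • u = 0) : u = 0 := by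
  obtain ⟨c, rfl⟩ := h.exists_eq_sum u
  refine Finset.sum_eq_zero fun i _ => ?_
  by_cases hi : i ∈ p.vertices
  · have h1 := terminalPart_smul_sum (π := π) hQ hi c x
    rw [hu] at h1
    rw [(smul_eq_zero.1 h1.symm).resolve_right h.smul_ne_zero, zero_smul]
  · rw [initialPart_of_notMem hi, zero_smul, smul_zero]

theorem vertexIdem_smul_eq (hQ : QuiverIsAcyclic Q) (i : Q) (u : U) :
    ∃ c : K, vertexIdem π i • u = c • initialPart π p i • x := by
  obtain ⟨c, rfl⟩ := h.exists_eq_sum u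
  refine ⟨c i, ?_⟩
  rw [Finset.smul_sum, Finset.sum_eq_single i]
  · rw [smul_comm, ← mul_smul, vertexIdem_mul_initialPart hQ]
  · intro j _ hj
    rw [← vertexIdem_mul_initialPart hQ, smul_comm, ← mul_smul, ← mul_assoc,
      vertexIdem_mul_of_ne π hj.symm, zero_mul, zero_smul, smul_zero]
  · exact fun h => absurd (Finset.mem_univ i) h

theorem vertexIdem_smul_of_notMem (hQ : QuiverIsAcyclic Q) {i : Q} (hi : i ∉ p.vertices) (u : U) :
    vertexIdem π i • u = 0 := by
  obtain ⟨c, hc⟩ := h.vertexIdem_smul_eq hQ i u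
  rw [hc, initialPart_of_notMem hi, zero_smul, smul_zero]

theorem vertexIdem_smul_eq_zero (hQ : QuiverIsAcyclic Q) (hπ : Function.Surjective π) {z : U}
    (hz : z ∈ radicalSubmodule Λ U) : vertexIdem π a • z = 0 := by
  refine Submodule.smul_induction_on hz (fun r hr u _ => ?_) (fun y z hy hz => ?_)
  · obtain ⟨c, rfl⟩ := h.exists_eq_sum u
    rw [Finset.smul_sum, Finset.smul_sum]
    refine Finset.sum_eq_zero fun i _ => ?_
    rw [smul_comm r, smul_comm _ (c i), ← mul_smul, ← mul_smul,
      vertexIdem_start_mul_mul_initialPart hQ hπ hr, zero_smul, smul_zero]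
  · rw [smul_add, hy, hz, add_zero]

theorem pathClass_smul_eq_zero (hQ : QuiverIsAcyclic Q) (hπ : Function.Surjective π) {z : U}
    (hz : z ∈ radicalSubmodule Λ U) : pathClass π p • z = 0 := by
  rw [← pathClass_mul_vertexIdem, mul_smul, h.vertexIdem_smul_eq_zero hQ hπ hz, smul_zero]

theorem notMem_radicalSubmodule (hQ : QuiverIsAcyclic Q) (hπ : Function.Surjective π) :
    x ∉ radicalSubmodule Λ U := fun hx =>
  h.smul_ne_zero (h.pathClass_smul_eq_zero hQ hπ hx)

theorem exists_sub_mem_radicalSubmodule (hQ : QuiverIsAcyclic Q) (hπ : Function.Surjective π)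
    (u : U) : ∃ c : K, u - c • x ∈ radicalSubmodule Λ U := by
  classical
  obtain ⟨c, rfl⟩ := h.exists_eq_sum u
  refine ⟨c a, ?_⟩
  rw [← Finset.add_sum_erase _ _ (Finset.mem_univ a), initialPart_start hQ, h.vertexIdem_smul,
    add_sub_cancel_left]
  refine sum_mem fun i hi => ?_
  rw [smul_comm]
  by_cases hp : i ∈ p.vertices
  · obtain ⟨v, w, hvw⟩ := mem_vertices_iff_exists_comp.1 hp
    rw [initialPart_eq hQ hvw]
    exact mem_radicalSubmodule (pathClass_mem_jacobson hQ hπ v (Finset.ne_of_mem_erase hi).symm) _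
  · rw [initialPart_of_notMem hp, zero_smul]
    exact zero_mem _

/-- `px` spans the last layer of `U`. At `b` itself `r` has no diagonal part, no path leads from `b`
to an earlier vertex of `p`, and `U` has no component off `p`. -/
theorem jacobson_mul_pathClass_smul (hQ : QuiverIsAcyclic Q) (hπ : Function.Surjective π) {r : Λ}
    (hr : r ∈ Ring.jacobson Λ) : (r * pathClass π p) • x = 0 := by
  rw [← sum_vertexIdem_smul π ((r * pathClass π p) • x)]
  refine Finset.sum_eq_zero fun k _ => ?_
  by_cases hk : k ∈ p.vertices
  · rw [← mul_smul, ← vertexIdem_mul_pathClass π p, ← mul_assoc, ← mul_assoc]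
    by_cases hkb : k = b
    · subst hkb
      rw [(mem_jacobson_iff_vertexIdem hQ hπ).1 hr, zero_mul, zero_smul]
    · obtain ⟨v, w, -⟩ := mem_vertices_iff_exists_comp.1 hk
      rw [vertexIdem_mul_mul_vertexIdem_eq_zero hQ hπ w hkb, zero_mul, zero_smul]
  · exact h.vertexIdem_smul_of_notMem hQ hk _

end IsMastGenerator

end Mast

/-! ### Irreducible inclusions and maps to the quotient. -/

section Lifting

theorem LinearMap.exists_comp_eq_of_ker_le {R M N P : Type*} [Ring R] [AddCommGroup M] [Module R M]
    [AddCommGroup N] [Module R N] [AddCommGroup P] [Module R P] {q : M →ₗ[R] N}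
    (hq : Function.Surjective q) (f : M →ₗ[R] P) (h : ∀ m, q m = 0 → f m = 0) :
    ∃ t : N →ₗ[R] P, t ∘ₗ q = f := by
  refine ⟨(LinearMap.ker q).liftQ f h ∘ₗ (q.quotKerEquivOfSurjective hq).symm, ?_⟩
  ext m
  have : (q.quotKerEquivOfSurjective hq).symm (q m) = (LinearMap.ker q).mkQ m := by
    rw [LinearEquiv.symm_apply_eq]
    rfl
  rw [LinearMap.comp_apply, LinearMap.comp_apply, LinearEquiv.coe_coe, this]
  rfl

theorem exists_linearMap_apply_eq_of_generator {R M N : Type*} [Ring R] [AddCommGroup M]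
    [Module R M] [AddCommGroup N] [Module R N] {x : M} (hx : ∀ m, ∃ r : R, r • x = m) {y : N}
    (h : ∀ r : R, r • x = 0 → r • y = 0) : ∃ s : M →ₗ[R] N, s x = y := by
  obtain ⟨t, ht⟩ := LinearMap.exists_comp_eq_of_ker_le (q := LinearMap.toSpanSingleton R M x)
    hx (LinearMap.toSpanSingleton R N y) h
  refine ⟨t, ?_⟩
  simpa using LinearMap.congr_fun ht 1

universe u v

/-- A map to `U ⧸ N` either lifts to `U` or is a factor of `U → U ⧸ N`, if `N → U` is
irreducible. -/
theorem IsIrreducibleMap.exists_lift_or_exists_factor {R : Type u} [Ring R] [IsNoetherianRing R]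
    {U : Type v} [AddCommGroup U] [Module R U] {N : Submodule R U}
    (hN : IsIrreducibleMap N.subtype) {x : U} (hx : ∀ m, ∃ r : R, r • x = m)
    {V : Type u} [AddCommGroup V] [Module R V] [Module.Finite R V] (f : V →ₗ[R] U ⧸ N) :
    (∃ t : V →ₗ[R] U, N.mkQ ∘ₗ t = f) ∨ ∃ s : U →ₗ[R] V, f ∘ₗ s = N.mkQ := by
  -- `E` is the pullback of `U → U ⧸ N ← V`. Replacing `U` by the cyclic quotient of `R` puts `E` in
  -- the universe required by `IsIrreducibleMap`.
  let e := (LinearMap.toSpanSingleton R U x).quotKerEquivOfSurjective hx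
  let E : Submodule R ((R ⧸ LinearMap.ker (LinearMap.toSpanSingleton R U x)) × V) :=
    LinearMap.eqLocus (N.mkQ ∘ₗ e.toLinearMap ∘ₗ LinearMap.fst R _ V) (f ∘ₗ LinearMap.snd R _ V)
  let φ : N →ₗ[R] E := LinearMap.codRestrict E
    (LinearMap.inl R _ V ∘ₗ e.symm.toLinearMap ∘ₗ N.subtype) (fun z => by
      simp [E, LinearMap.mem_eqLocus])
  let ψ : E →ₗ[R] U := e.toLinearMap ∘ₗ LinearMap.fst R _ V ∘ₗ E.subtype
  have hE : ∀ z : E, N.mkQ (ψ z) = f z.1.2 := fun z => z.2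
  rcases hN.2.2 E φ ψ (LinearMap.ext fun z => e.apply_symm_apply _) with ⟨g, hg⟩ | ⟨s, hs⟩
  · left
    have hsurj : Function.Surjective (LinearMap.snd R _ V ∘ₗ E.subtype) := by
      intro y
      obtain ⟨w, hw⟩ := N.mkQ_surjective (f y)
      exact ⟨⟨(e.symm w, y), by simpa [E, LinearMap.mem_eqLocus] using hw⟩, rfl⟩
    -- The kernel of `E → V` is the image of `φ`, where `ψ` and the retraction `g` agree. So `ψ - g`
    -- descends to `V`; it is a lift of `f` because `g` takes values in `N`.
    obtain ⟨t, ht⟩ := LinearMap.exists_comp_eq_of_ker_le hsurj (ψ - N.subtype ∘ₗ g) (by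
      intro z hz
      have hz2 : z.1.2 = 0 := hz
      have hz1 : ψ z ∈ N := by
        rw [← Submodule.Quotient.mk_eq_zero, ← Submodule.mkQ_apply, hE, hz2, map_zero]
      have hzφ : z = φ ⟨ψ z, hz1⟩ := by
        refine Subtype.ext (Prod.ext ?_ hz2)
        exact (e.symm_apply_apply _).symm
      have : g z = ⟨ψ z, hz1⟩ := by
        conv_lhs => rw [hzφ]
        exact LinearMap.congr_fun hg _
      simp [this])
    refine ⟨t, LinearMap.ext fun y => ?_⟩
    obtain ⟨z, rfl⟩ := hsurj y
    have h1 : t ((LinearMap.snd R _ V ∘ₗ E.subtype) z) = ψ z - g z := LinearMap.congr_fun ht z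
    rw [LinearMap.comp_apply, h1, map_sub, hE]
    simp
  · right
    refine ⟨LinearMap.snd R _ V ∘ₗ E.subtype ∘ₗ s, LinearMap.ext fun y => ?_⟩
    have h1 : ψ (s y) = y := LinearMap.congr_fun hs y
    have h2 := hE (s y)
    rw [h1] at h2
    exact h2.symm

end Lifting

/-! ### From irreducibility to the ring-theoretic conditions. -/

section Necessity

variable {K : Type*} [Field K] {Q : Type*} [Quiver Q] [Fintype Q] [∀ i j : Q, Finite (i ⟶ j)]
  {Λ : Type*} [Ring Λ] [Algebra K Λ] {π : PathAlgebra K Q →ₐ[K] Λ} {a b : Q} {p : Path a b}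
  {U : Type*} [AddCommGroup U] [Module K U] [Module Λ U] [IsScalarTower K Λ U]

theorem IsAdmissiblePresentation.isNoetherianRing (hπ : IsAdmissiblePresentation π) :
    IsNoetherianRing Λ := by
  have := hπ.moduleFinite
  exact IsNoetherianRing.of_finite K Λ

omit [∀ i j : Q, Finite (i ⟶ j)] in
-- `τ e_a` lies in `e_b Λ p`, and modulo the vanishing of `τ x` only a scalar multiple of `p` is
-- left to exclude; `px ≠ 0` does this.
theorem IsMastGenerator.mul_vertexIdem_eq_zero {x : U} (h : IsMastGenerator π p x)
    (hQ : QuiverIsAcyclic Q) (hπ : Function.Surjective π)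
    (hA : ∀ l : Λ, l • x = 0 → ∃ l' : Λ, l * vertexIdem π a = l' * pathClass π p) {τ : Λ}
    (hτ : vertexIdem π b * τ = τ) (hx : τ • x = 0) : τ * vertexIdem π a = 0 := by
  obtain ⟨l', hl'⟩ := hA τ hx
  obtain ⟨c, hc⟩ := vertexIdem_mul_mul_vertexIdem_eq_smul hQ hπ b l'
  have h1 : τ * vertexIdem π a = c • pathClass π p := by
    rw [← hτ, mul_assoc, hl', ← vertexIdem_mul_pathClass π p, ← mul_assoc, ← mul_assoc, hc,
      smul_mul_assoc]
  have h2 : c • pathClass π p • x = 0 := by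
    rw [← smul_assoc, ← h1, mul_smul, h.vertexIdem_smul, hx]
  rw [h1, (smul_eq_zero.1 h2).resolve_right h.smul_ne_zero, zero_smul]

theorem IsMastGenerator.exists_relations {x : U} (h : IsMastGenerator π p x)
    (hQ : QuiverIsAcyclic Q) (hπ : IsAdmissiblePresentation π) (hab : a ≠ b)
    (hirr : IsIrreducibleMap (radicalSubmodule Λ U).subtype) (s : Finset Λ)
    (hs : ∀ τ ∈ s, ∀ u : U, τ • u = 0) :
    ∃ f : Λ → Λ, ∀ l : Λ, l • x = 0 → ∃ l' : Λ, l * vertexIdem π a = l' * pathClass π p ∧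
      ∀ τ ∈ s, l * vertexIdem π a * f τ = -(l' * τ) := by
  classical
  have := hπ.isNoetherianRing
  set N := radicalSubmodule Λ U with hN
  -- The relation `p ε = ∑ τ ε_τ` of the test module.
  let ρ : Λ × (s → Λ) := (pathClass π p, fun τ => -τ.1)
  let L : Submodule Λ (Λ × (s → Λ)) := Submodule.span Λ {ρ}
  let f : ((Λ × (s → Λ)) ⧸ L) →ₗ[Λ] U ⧸ N :=
    L.liftQ (N.mkQ ∘ₗ LinearMap.toSpanSingleton Λ U x ∘ₗ LinearMap.fst Λ Λ (s → Λ)) (by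
      rw [Submodule.span_singleton_le_iff_mem, LinearMap.mem_ker]
      simp only [LinearMap.comp_apply, LinearMap.fst_apply, LinearMap.toSpanSingleton_apply,
        Submodule.mkQ_apply, Submodule.Quotient.mk_eq_zero, ρ]
      exact mem_radicalSubmodule (pathClass_mem_jacobson hQ hπ.1 p hab) x)
  have hf : ∀ y, f (L.mkQ y) = N.mkQ (y.1 • x) := fun y => rfl
  rcases hirr.exists_lift_or_exists_factor h.exists_smul_eq f with ⟨t, ht⟩ | ⟨t, ht⟩
  -- A lift sends `ε` to some `y ∈ x + N`. Then `p y = p x ≠ 0`, whereas the relation forces `p y =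
  -- 0` since every `τ` kills `U`.
  · exfalso
    set y := t (L.mkQ (1, 0)) with hy
    have h1 : y - x ∈ N := by
      rw [← Submodule.Quotient.mk_eq_zero, ← Submodule.mkQ_apply, map_sub, hy]
      have := LinearMap.congr_fun ht (L.mkQ (1, 0))
      rw [LinearMap.comp_apply, hf, one_smul] at this
      rw [this, sub_self]
    have h2 := h.pathClass_smul_eq_zero hQ hπ.1 h1
    have h3 : ρ = pathClass π p • ((1, 0) : Λ × (s → Λ)) +
        ∑ τ : s, (-τ.1) • ((0, Pi.single τ 1) : Λ × (s → Λ)) := by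
      refine Prod.ext ?_ ?_
      · simp [ρ, Prod.fst_sum]
      · ext τ
        simp [ρ, Prod.snd_sum, Finset.sum_apply, Pi.single_apply]
    have h4 : t (L.mkQ ρ) = 0 := by
      have : L.mkQ ρ = 0 := by
        rw [Submodule.mkQ_apply, Submodule.Quotient.mk_eq_zero]
        exact Submodule.mem_span_singleton_self ρ
      rw [this, map_zero]
    rw [h3, map_add, map_add, map_smul, map_smul, ← hy, map_sum, map_sum,
      Finset.sum_eq_zero, add_zero] at h4
    · rw [smul_sub, h4, zero_sub, neg_eq_zero] at h2
      exact h.smul_ne_zero h2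
    · intro τ _
      rw [map_smul, map_smul, neg_smul, hs τ τ.2, neg_zero]
  · obtain ⟨⟨q, g⟩, hqg⟩ := L.mkQ_surjective (t x)
    have h1 : q • x - x ∈ N := by
      rw [← Submodule.Quotient.mk_eq_zero, ← Submodule.mkQ_apply, map_sub, ← hf (q, g), hqg,
        sub_eq_zero]
      exact LinearMap.congr_fun ht x
    -- This scalar multiple of `e_a` fixes `x ≠ 0` because `q • x - x ∈ N` and `e_a N = 0`.
    have h2 : vertexIdem π a * q * vertexIdem π a = vertexIdem π a := by
      obtain ⟨c, hc⟩ := vertexIdem_mul_mul_vertexIdem_eq_smul hQ hπ.1 a q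
      have h3 := h.vertexIdem_smul_eq_zero hQ hπ.1 h1
      rw [smul_sub, h.vertexIdem_smul, sub_eq_zero] at h3
      have h4 : c • x = x := by
        conv_rhs => rw [← h3, ← h.vertexIdem_smul, ← mul_smul, ← mul_smul, hc,
          smul_assoc, h.vertexIdem_smul]
      have hx0 : x ≠ 0 := fun h0 => h.smul_ne_zero (by rw [h0, smul_zero])
      have h5 : (c - 1) • x = 0 := by rw [sub_smul, one_smul, h4, sub_self]
      rw [hc, sub_eq_zero.1 ((smul_eq_zero.1 h5).resolve_right hx0), one_smul]
    refine ⟨fun τ => if hτ : τ ∈ s then g ⟨τ, hτ⟩ else 0, fun l hl => ?_⟩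
    have h3 : (l * vertexIdem π a) • t x = 0 := by
      rw [mul_smul, ← map_smul, h.vertexIdem_smul, ← map_smul, hl, map_zero]
    rw [← hqg, ← map_smul, Submodule.mkQ_apply, Submodule.Quotient.mk_eq_zero] at h3
    obtain ⟨l', hl'⟩ := Submodule.mem_span_singleton.1 h3
    have h4 : l' * pathClass π p = l * vertexIdem π a * q := congrArg Prod.fst hl'
    refine ⟨l', ?_, fun τ hτ => ?_⟩
    · rw [← pathClass_mul_vertexIdem, ← mul_assoc, h4, mul_assoc, mul_assoc, ← mul_assoc _ q, h2]
    · have h5 := congrFun (congrArg Prod.snd hl') ⟨τ, hτ⟩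
      simp only [dif_pos hτ]
      rw [← mul_neg]
      exact h5.symm

theorem IsMastGenerator.exists_set_of_isIrreducibleMap {x : U} (h : IsMastGenerator π p x)
    (hQ : QuiverIsAcyclic Q) (hπ : IsAdmissiblePresentation π) (hab : a ≠ b)
    (hirr : IsIrreducibleMap (radicalSubmodule Λ U).subtype) :
    (∀ l : Λ, l • x = 0 → ∃ l' : Λ, l * vertexIdem π a = l' * pathClass π p) ∧
    ∃ R ⊆ (Ring.jacobson Λ : Set Λ),
      (∀ r ∈ Ring.jacobson Λ, ∃ l ∈ R, l * pathClass π p = r * pathClass π p) ∧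
      ∀ τ : Λ, vertexIdem π b * τ = τ → (∀ u : U, τ • u = 0) →
        ∃ w ∈ Ring.jacobson Λ, ∀ l ∈ R, l * τ = l * pathClass π p * w := by
  have hs := hπ.1
  have hA : ∀ l : Λ, l • x = 0 → ∃ l' : Λ, l * vertexIdem π a = l' * pathClass π p := by
    obtain ⟨f, hf⟩ := h.exists_relations hQ hπ hab hirr ∅ (by simp)
    exact fun l hl => (hf l hl).imp fun _ => And.left
  have hp0 : pathClass π p ≠ 0 := fun h0 => h.smul_ne_zero (by rw [h0, zero_smul])
  refine ⟨hA, ?_⟩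
  have := hπ.moduleFinite
  let T : Submodule K Λ :=
    { carrier := {τ | vertexIdem π b * τ = τ ∧ ∀ u : U, τ • u = 0}
      add_mem' := fun {τ τ'} h1 h2 => ⟨by rw [mul_add, h1.1, h2.1],
        fun u => by rw [add_smul, h1.2, h2.2, add_zero]⟩
      zero_mem' := ⟨mul_zero _, fun u => zero_smul _ u⟩
      smul_mem' := fun c τ h1 => ⟨by rw [mul_smul_comm, h1.1],
        fun u => by rw [smul_assoc, h1.2, smul_zero]⟩ }
  obtain ⟨s, hsT⟩ := (IsNoetherian.noetherian T : T.FG)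
  have hsub : ∀ τ ∈ s, τ ∈ T := fun τ hτ => hsT ▸ Submodule.subset_span hτ
  obtain ⟨f, hf⟩ := h.exists_relations hQ hπ hab hirr s fun τ hτ => (hsub τ hτ).2
  -- The largest admissible `R`: all `l ∈ J` satisfying the desired identity on the generators `s`
  -- of `T`. Linearity extends the identity to `T`.
  refine ⟨{l | l ∈ Ring.jacobson Λ ∧ ∀ τ ∈ s, l * τ = l * pathClass π p * -f τ},
    fun l hl => hl.1, fun r hr => ?_, fun τ h1 h2 => ?_⟩
  · obtain ⟨l', h1, h2⟩ := hf (r * pathClass π p) (h.jacobson_mul_pathClass_smul hQ hs hr)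
    rw [mul_assoc, pathClass_mul_vertexIdem] at h1 h2
    have h3 : l' * vertexIdem π b * pathClass π p = r * pathClass π p := by
      rw [mul_assoc, vertexIdem_mul_pathClass, h1]
    -- Cutting by `e_b` changes neither `l' p` nor `l' τ`, and leaves `b` as the only possible
    -- diagonal entry; that entry is zero because `l' p = r p` with `r ∈ J` and `p ≠ 0`.
    refine ⟨l' * vertexIdem π b, ⟨?_, fun τ hτ => ?_⟩, h3⟩
    · rw [mem_jacobson_iff_vertexIdem hQ hs]
      intro i
      by_cases hi : b = i
      · subst hi
        obtain ⟨c, hc⟩ := vertexIdem_mul_mul_vertexIdem_eq_smul hQ hs b l'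
        have h4 : c • pathClass π p = 0 := by
          rw [← vertexIdem_mul_pathClass π p, ← smul_mul_assoc, ← hc, mul_assoc,
            vertexIdem_mul_pathClass, mul_assoc, ← h1, ← vertexIdem_mul_pathClass π p,
            ← mul_assoc, ← mul_assoc, (mem_jacobson_iff_vertexIdem hQ hs).1 hr, zero_mul]
        rw [mul_assoc, mul_assoc, vertexIdem_mul_self, ← mul_assoc, hc,
          (smul_eq_zero.1 h4).resolve_right hp0, zero_smul]
      · rw [mul_assoc, mul_assoc, vertexIdem_mul_of_ne π hi, mul_zero, mul_zero]
    · rw [h3, mul_neg, h2 τ hτ, neg_neg, mul_assoc, (hsub τ hτ).1]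
  · have h3 : ∃ v : Λ, ∀ l ∈ {l | l ∈ Ring.jacobson Λ ∧
        ∀ τ ∈ s, l * τ = l * pathClass π p * -f τ}, l * τ = l * pathClass π p * v := by
      have hτ : τ ∈ Submodule.span K (s : Set Λ) := hsT ▸ (⟨h1, h2⟩ : τ ∈ T)
      induction hτ using Submodule.span_induction with
      | mem τ hτ => exact ⟨-f τ, fun l hl => hl.2 τ hτ⟩
      | zero => exact ⟨0, fun l _ => by rw [mul_zero, mul_zero]⟩
      | add y z hy hz ihy ihz =>
        rw [hsT] at hy hz
        obtain ⟨v, hv⟩ := ihy hy.1 hy.2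
        obtain ⟨w, hw⟩ := ihz hz.1 hz.2
        exact ⟨v + w, fun l hl => by rw [mul_add, mul_add, hv l hl, hw l hl]⟩
      | smul c y hy ihy =>
        rw [hsT] at hy
        obtain ⟨v, hv⟩ := ihy hy.1 hy.2
        exact ⟨c • v, fun l hl => by rw [mul_smul_comm, mul_smul_comm, hv l hl]⟩
    obtain ⟨v, hv⟩ := h3
    have h4 := h.mul_vertexIdem_eq_zero hQ hs hA h1 (h2 x)
    -- Removing the component at `a` puts the factor in `J`; it costs nothing since `τ e_a = 0`.
    refine ⟨vertexIdem π a * v * (1 - vertexIdem π a), ?_, fun l hl => ?_⟩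
    · rw [mem_jacobson_iff_vertexIdem hQ hs]
      intro i
      by_cases hi : i = a
      · subst hi
        rw [mul_assoc, mul_assoc, sub_mul, one_mul, vertexIdem_mul_self, sub_self, mul_zero,
          mul_zero]
      · rw [← mul_assoc, ← mul_assoc, vertexIdem_mul_of_ne π hi, zero_mul, zero_mul, zero_mul]
    · have h5 : l * pathClass π p * (vertexIdem π a * v) = l * τ := by
        rw [← mul_assoc, mul_assoc l, pathClass_mul_vertexIdem, hv l hl]
      rw [← mul_assoc, h5, mul_sub, mul_one, mul_assoc, h4, mul_zero, sub_zero]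

end Necessity

/-! ### From the ring-theoretic conditions to irreducibility. -/

section Sufficiency

variable {K : Type*} [Field K] {Q : Type*} [Quiver Q] [Fintype Q]
  {Λ : Type*} [Ring Λ] [Algebra K Λ] {π : PathAlgebra K Q →ₐ[K] Λ} {a b : Q} {p : Path a b}
  {U : Type*} [AddCommGroup U] [Module K U] [Module Λ U] [IsScalarTower K Λ U]

/-- A functional on `V` that vanishes on `τ V`, for all `τ` ending at `b` with `τ U = 0`, is induced
by a homomorphism `V → U`. -/
theorem IsMastGenerator.exists_linearMap_of_functional {x : U} (h : IsMastGenerator π p x)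
    (hQ : QuiverIsAcyclic Q) {V : Type*} [AddCommGroup V] [Module K V] [Module Λ V]
    [IsScalarTower K Λ V] (f : V →ₗ[K] K)
    (hf : ∀ τ : Λ, vertexIdem π b * τ = τ → (∀ u : U, τ • u = 0) → ∀ y : V, f (τ • y) = 0) :
    ∃ g : V →ₗ[Λ] U, ∀ τ : Λ, vertexIdem π b * τ = τ → ∀ y : V,
      τ • g y = f (τ • y) • pathClass π p • x := by
  have hinj : ∀ u u' : U, (∀ τ : Λ, vertexIdem π b * τ = τ → τ • u = τ • u') → u = u' := by
    intro u u' huu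
    rw [← sub_eq_zero]
    refine h.eq_zero_of_terminalPart_smul hQ fun i => ?_
    rw [smul_sub, huu _ (vertexIdem_mul_terminalPart hQ i), sub_self]
  have hex : ∀ y : V, ∃ u : U, ∀ τ : Λ, vertexIdem π b * τ = τ →
      τ • u = f (τ • y) • pathClass π p • x := by
    intro y
    -- The coordinates of `u` are forced by taking `τ` to be the terminal parts. A general `τ`
    -- differs from a combination of these by an element killing `U`, which `f` ignores by `hf`.
    refine ⟨∑ i, f (terminalPart π p i • y) • initialPart π p i • x, fun τ hτ => ?_⟩
    have hc : ∀ i, ∃ c : K, τ • initialPart π p i • x = c • pathClass π p • x := by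
      intro i
      obtain ⟨c, hc⟩ := h.vertexIdem_smul_eq hQ b (τ • initialPart π p i • x)
      rw [← mul_smul, hτ, initialPart_end hQ] at hc
      exact ⟨c, hc⟩
    choose c hc using hc
    have hzero : ∀ u : U, (τ - ∑ i, c i • terminalPart π p i) • u = 0 := by
      intro u
      obtain ⟨d, rfl⟩ := h.exists_eq_sum u
      rw [Finset.smul_sum]
      refine Finset.sum_eq_zero fun k _ => ?_
      rw [smul_comm, sub_smul, hc, Finset.sum_smul, Finset.sum_eq_single k]
      · by_cases hk : k ∈ p.vertices
        · rw [smul_assoc, ← mul_smul, terminalPart_mul_initialPart hQ hk, sub_self, smul_zero]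
        · rw [← hc, initialPart_of_notMem hk, zero_smul, smul_zero, smul_zero, sub_zero, smul_zero]
      · intro j _ hj
        rw [smul_assoc, ← mul_smul, terminalPart_mul_initialPart_of_ne hQ hj, zero_smul,
          smul_zero]
      · exact fun h => absurd (Finset.mem_univ k) h
    have h0 := hf _ (by
      rw [mul_sub, hτ, Finset.mul_sum]
      simp only [mul_smul_comm, vertexIdem_mul_terminalPart hQ]) hzero y
    rw [sub_smul, map_sub, sub_eq_zero] at h0
    rw [h0, Finset.sum_smul, map_sum, Finset.sum_smul, Finset.smul_sum]
    refine Finset.sum_congr rfl fun i _ => ?_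
    rw [smul_comm, hc, smul_assoc, map_smul f, smul_smul, smul_eq_mul, mul_comm]
  choose g hg using hex
  refine ⟨{ toFun := g, map_add' := fun y z => hinj _ _ fun τ hτ => ?_,
            map_smul' := fun l y => hinj _ _ fun τ hτ => ?_ }, fun τ hτ y => hg y τ hτ⟩
  · rw [smul_add, hg _ _ hτ, hg _ _ hτ, hg _ _ hτ, smul_add, map_add, add_smul]
  · rw [RingHom.id_apply, hg _ _ hτ, ← mul_smul, ← mul_smul, hg _ _ (by rw [← mul_assoc, hτ])]

theorem IsMastGenerator.isSplitMonomorphism_or_isSplitEpimorphism {x : U}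
    (h : IsMastGenerator π p x) (hQ : QuiverIsAcyclic Q) (hπ : Function.Surjective π)
    (hA : ∀ l : Λ, l • x = 0 → ∃ l' : Λ, l * vertexIdem π a = l' * pathClass π p)
    {R : Set Λ}
    (hspan : ∀ r ∈ Ring.jacobson Λ,
      r * pathClass π p ∈ Submodule.span Λ ((· * pathClass π p) '' R))
    (hB : ∀ τ : Λ, vertexIdem π b * τ = τ → (∀ u : U, τ • u = 0) →
      ∃ w ∈ Ring.jacobson Λ, ∀ r ∈ R, r * τ = r * pathClass π p * w)
    {V : Type*} [AddCommGroup V] [Module K V] [Module Λ V] [IsScalarTower K Λ V]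
    (φ : radicalSubmodule Λ U →ₗ[Λ] V) (ψ : V →ₗ[Λ] U)
    (hφψ : ψ ∘ₗ φ = (radicalSubmodule Λ U).subtype) :
    IsSplitMonomorphism φ ∨ IsSplitEpimorphism ψ := by
  have hψφ : ∀ z : radicalSubmodule Λ U, ψ (φ z) = z := fun z => LinearMap.congr_fun hφψ z
  by_cases hψ : ∀ y, ψ y ∈ radicalSubmodule Λ U
  · exact Or.inl ⟨ψ.codRestrict _ hψ, LinearMap.ext fun z => Subtype.ext (hψφ z)⟩
  push Not at hψ
  have hψK : ∀ (c : K) (y : V), ψ (c • y) = c • ψ y := fun c y => by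
    rw [← algebraMap_smul Λ c y, map_smul, algebraMap_smul]
  have hNK : ∀ (c : K) {u : U}, u ∈ radicalSubmodule Λ U →
      c • u ∈ radicalSubmodule Λ U := fun c u hu => by
    rw [← algebraMap_smul Λ c u]; exact (radicalSubmodule Λ U).smul_mem _ hu
  obtain ⟨y₀, hy₀⟩ : ∃ y₀ : V, ψ y₀ = x := by
    obtain ⟨y, hy⟩ := hψ
    obtain ⟨c, hc⟩ := h.exists_sub_mem_radicalSubmodule hQ hπ (ψ y)
    have hc0 : c ≠ 0 := by
      rintro rfl
      rw [zero_smul, sub_zero] at hc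
      exact hy hc
    refine ⟨c⁻¹ • (y - φ ⟨_, hc⟩), ?_⟩
    rw [hψK, map_sub, hψφ, sub_sub_cancel, smul_smul, inv_mul_cancel₀ hc0, one_smul]
  have hJ : ∀ r ∈ Ring.jacobson Λ, (r * pathClass π p) • x = 0 :=
    fun r hr => h.jacobson_mul_pathClass_smul hQ hπ hr
  -- `p y₀ ∈ Y` says that, for a correction `k` with `ψ k ∈ N`, each `rp`, `r ∈ R`, sends `y₀ - k`
  -- into the image of `φ`.
  let Y : Submodule K V :=
    { carrier := {z | ∃ k, ψ k ∈ radicalSubmodule Λ U ∧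
        ∀ r ∈ R, r • z - (r * pathClass π p) • k ∈ LinearMap.range φ}
      add_mem' := by
        rintro z z' ⟨k, hk, hk'⟩ ⟨m, hm, hm'⟩
        refine ⟨k + m, by rw [map_add]; exact (radicalSubmodule Λ U).add_mem hk hm, fun r hr => ?_⟩
        rw [smul_add, smul_add, add_sub_add_comm]
        exact add_mem (hk' r hr) (hm' r hr)
      zero_mem' := ⟨0, by rw [map_zero]; exact (radicalSubmodule Λ U).zero_mem, fun r _ => by
        rw [smul_zero, smul_zero, sub_zero]; exact zero_mem _⟩
      smul_mem' := by
        rintro c z ⟨k, hk, hk'⟩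
        refine ⟨c • k, by rw [hψK]; exact hNK c hk, fun r hr => ?_⟩
        rw [smul_comm r, smul_comm (r * _), ← smul_sub, ← algebraMap_smul Λ c]
        exact Submodule.smul_mem _ _ (hk' r hr) }
  by_cases hpY : pathClass π p • y₀ ∈ Y
  · right
    obtain ⟨k, hk, hk'⟩ := hpY
    have h1 : ∀ r ∈ Ring.jacobson Λ, (r * pathClass π p) • (y₀ - k) ∈ LinearMap.range φ := by
      intro r hr
      have hle : Submodule.span Λ ((· * pathClass π p) '' R) ≤
          (LinearMap.range φ).comap (LinearMap.toSpanSingleton Λ V (y₀ - k)) := by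
        rw [Submodule.span_le]
        rintro _ ⟨l, hl, rfl⟩
        have := hk' l hl
        rw [← mul_smul, ← smul_sub] at this
        exact this
      exact hle (hspan r hr)
    -- Adding `φ (ψ k)` restores the image `x` under `ψ`. A relation `l x = 0` has `l e_a = r p`
    -- with `r ∈ J`, so it sends this element into the image of `φ`, on which `ψ` is injective, and
    -- `r p x = 0`.
    obtain ⟨s, hs⟩ := exists_linearMap_apply_eq_of_generator (N := V) h.exists_smul_eq
      (y := vertexIdem π a • (y₀ - k + φ ⟨ψ k, hk⟩)) (by
        intro l hl
        obtain ⟨l', hl'⟩ := hA l hl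
        obtain ⟨c, hc⟩ := vertexIdem_mul_mul_vertexIdem_eq_smul hQ hπ b l'
        set r := l' * vertexIdem π b - vertexIdem π b * l' * vertexIdem π b with hr
        have hrJ : r ∈ Ring.jacobson Λ := by
          rw [mem_jacobson_iff_vertexIdem hQ hπ]
          intro i
          have e1 : vertexIdem π i * r * vertexIdem π i =
              (vertexIdem π i - vertexIdem π i * vertexIdem π b) * l' *
                (vertexIdem π b * vertexIdem π i) := by rw [hr]; noncomm_ring
          rw [e1]
          by_cases hi : i = b
          · rw [hi, vertexIdem_mul_self, sub_self, zero_mul, zero_mul]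
          · rw [vertexIdem_mul_of_ne π (Ne.symm hi), mul_zero]
        have h2 : l * vertexIdem π a = r * pathClass π p + c • pathClass π p := by
          rw [hr, sub_mul, hc, smul_mul_assoc, mul_assoc, vertexIdem_mul_pathClass,
            sub_add_cancel, hl']
        have h3 : c • pathClass π p • x = 0 := by
          have := congrArg (· • x) h2
          simp only [add_smul, hJ r hrJ, zero_add, mul_smul l, h.vertexIdem_smul, hl] at this
          rw [← smul_assoc, ← this]
        rw [(smul_eq_zero.1 h3).resolve_right h.smul_ne_zero, zero_smul, add_zero] at h2
        rw [← mul_smul, h2, smul_add]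
        obtain ⟨z, hz⟩ := add_mem (h1 r hrJ)
          (Submodule.smul_mem (LinearMap.range φ) (r * pathClass π p) ⟨⟨ψ k, hk⟩, rfl⟩)
        have h4 : ψ (φ z) = 0 := by
          rw [hz, ← smul_add, map_smul, map_add, map_sub, hψφ, sub_add_cancel, hy₀, hJ r hrJ]
        rw [hψφ] at h4
        have h5 : z = 0 := Subtype.ext h4
        rw [← hz, h5, map_zero])
    refine ⟨s, LinearMap.ext fun u => ?_⟩
    obtain ⟨l, rfl⟩ := h.exists_smul_eq u
    rw [LinearMap.comp_apply, map_smul, hs, map_smul, map_smul, map_add, map_sub, hψφ,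
      sub_add_cancel, hy₀, h.vertexIdem_smul, LinearMap.id_apply]
  · left
    obtain ⟨f₀, hf₀, hf₀Y⟩ := Submodule.exists_le_ker_of_notMem hpY
    set f := (f₀ (pathClass π p • y₀))⁻¹ • f₀ with hf
    have hfy₀ : f (pathClass π p • y₀) = 1 := by
      rw [hf, LinearMap.smul_apply, smul_eq_mul, inv_mul_cancel₀ hf₀]
    have hfY : ∀ z ∈ Y, f z = 0 := by
      intro z hz
      have : f₀ z = 0 := hf₀Y hz
      rw [hf, LinearMap.smul_apply, this, smul_zero]
    obtain ⟨g, hg⟩ := h.exists_linearMap_of_functional hQ f (by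
      intro τ hτ hτ' y
      obtain ⟨w, hw, hw'⟩ := hB τ hτ hτ'
      refine hfY _ ⟨w • y, ?_, fun r hr => ?_⟩
      · rw [map_smul]
        exact mem_radicalSubmodule hw _
      · rw [← mul_smul, ← mul_smul, hw' r hr, sub_self]
        exact zero_mem _)
    have hrange : ∀ z : radicalSubmodule Λ U, φ z ∈ Y := fun z => ⟨0, by
      rw [map_zero]; exact (radicalSubmodule Λ U).zero_mem,
      fun r _ => by
        rw [smul_zero, sub_zero]
        exact Submodule.smul_mem _ _ ⟨z, rfl⟩⟩
    have hgφ : ∀ z : radicalSubmodule Λ U, g (φ z) = 0 := by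
      intro z
      refine h.eq_zero_of_terminalPart_smul hQ fun i => ?_
      rw [hg _ (vertexIdem_mul_terminalPart hQ i), ← map_smul, hfY _ (hrange _), zero_smul]
    have hker : ∀ y : V, ψ y ∈ radicalSubmodule Λ U → f (pathClass π p • y) = 0 := fun y hy =>
      hfY _ ⟨y, hy, fun r _ => by rw [mul_smul, sub_self]; exact zero_mem _⟩
    -- `f (p y)` is the coefficient of `x` in both `ψ y` and `g y` modulo `N`: for `ψ` by `hker` and
    -- `f (p y₀) = 1`, for `g` by its defining property.
    have hgψ : ∀ y : V, (ψ - g) y ∈ radicalSubmodule Λ U := by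
      intro y
      obtain ⟨c, hc⟩ := h.exists_sub_mem_radicalSubmodule hQ hπ (ψ y)
      obtain ⟨d, hd⟩ := h.exists_sub_mem_radicalSubmodule hQ hπ (g y)
      have h1 : f (pathClass π p • y) = c := by
        have := hker (y - c • y₀) (by rwa [map_sub, hψK, hy₀])
        rwa [smul_sub, smul_comm, map_sub, map_smul f, hfy₀, smul_eq_mul, mul_one,
          sub_eq_zero] at this
      have h2 := hg (pathClass π p) (vertexIdem_mul_pathClass π p) y
      have h3 := h.pathClass_smul_eq_zero hQ hπ hd
      rw [smul_sub, h2, h1, smul_comm (pathClass π p) d x, ← sub_smul] at h3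
      have h4 := sub_eq_zero.1 ((smul_eq_zero.1 h3).resolve_right h.smul_ne_zero)
      rw [LinearMap.sub_apply]
      rw [← h4] at hd
      simpa using (radicalSubmodule Λ U).sub_mem hc hd
    exact ⟨(ψ - g).codRestrict _ hgψ, LinearMap.ext fun z => Subtype.ext (by
      simp [hψφ, hgφ])⟩

theorem IsMastGenerator.isIrreducibleMap {x : U}
    (h : IsMastGenerator π p x) (hQ : QuiverIsAcyclic Q) (hπ : Function.Surjective π)
    (hab : a ≠ b)
    (hA : ∀ l : Λ, l • x = 0 → ∃ l' : Λ, l * vertexIdem π a = l' * pathClass π p)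
    {R : Set Λ}
    (hspan : ∀ r ∈ Ring.jacobson Λ,
      r * pathClass π p ∈ Submodule.span Λ ((· * pathClass π p) '' R))
    (hB : ∀ τ : Λ, vertexIdem π b * τ = τ → (∀ u : U, τ • u = 0) →
      ∃ w ∈ Ring.jacobson Λ, ∀ r ∈ R, r * τ = r * pathClass π p * w) :
    IsIrreducibleMap (radicalSubmodule Λ U).subtype := by
  refine ⟨?_, ?_, ?_⟩
  · rintro ⟨g, hg⟩
    -- A retraction sends `x = e_a x` into `e_a N = 0`, yet it must fix `px ∈ N`.
    have hgx : g x = 0 := by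
      rw [← h.vertexIdem_smul, map_smul]
      exact Subtype.ext (h.vertexIdem_smul_eq_zero hQ hπ (g x).2)
    have hpx := mem_radicalSubmodule (pathClass_mem_jacobson hQ hπ p hab) x
    have h1 : g (pathClass π p • x) = ⟨pathClass π p • x, hpx⟩ := LinearMap.congr_fun hg ⟨_, hpx⟩
    rw [map_smul, hgx, smul_zero] at h1
    exact h.smul_ne_zero (congrArg Subtype.val h1).symm
  · rintro ⟨g, hg⟩
    have h1 : ((g x : radicalSubmodule Λ U) : U) = x := LinearMap.congr_fun hg x
    exact h.notMem_radicalSubmodule hQ hπ (h1 ▸ (g x).2)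
  · intro V _ _ _ φ ψ hφψ
    let _ : Module K V := Module.compHom V (algebraMap K Λ)
    have : IsScalarTower K Λ V := IsScalarTower.of_algebraMap_smul fun _ _ => rfl
    exact h.isSplitMonomorphism_or_isSplitEpimorphism hQ hπ hA hspan hB φ ψ hφψ

end Sufficiency

/-! ### The arrow conditions and their ring-theoretic forms. -/

section Conditions

variable {K : Type*} [Field K] {Q : Type*} [Quiver Q] [Fintype Q]
  {Λ : Type*} [Ring Λ] [Algebra K Λ] {π : PathAlgebra K Q →ₐ[K] Λ} {a b : Q} {p : Path a b}
  {U : Type*} [AddCommGroup U] [Module K U] [Module Λ U] [IsScalarTower K Λ U]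

theorem IsArrowOf.exists_eq_comp {Q : Type*} [Quiver Q] {a b i j : Q} (hQ : QuiverIsAcyclic Q)
    {p : Path a b} {δ : i ⟶ j} (hδ : IsArrowOf δ p) {u : Path a i} {w : Path i b}
    (h : p = u.comp w) : ∃ w' : Path j b, p = (u.cons δ).comp w' ∧ w = δ.toPath.comp w' := by
  obtain ⟨v, w', hv⟩ := hδ
  have h1 : p = v.comp (δ.toPath.comp w') := by
    rw [hv, ← Path.comp_assoc, Path.comp_toPath_eq_cons]
  obtain ⟨rfl, rfl⟩ := hQ.comp_eq_comp (h.symm.trans h1)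
  exact ⟨w', hv, rfl⟩

theorem mem_leftTimes {L : Ideal Λ} {z l : Λ} : l ∈ leftTimes K L z ↔ ∃ r ∈ L, r * z = l :=
  Iff.rfl

theorem mem_timesLeft {L : Ideal Λ} {z l : Λ} : l ∈ timesLeft K z L ↔ ∃ r ∈ L, z * r = l :=
  Iff.rfl

theorem ConditionA.pathClass_mul_initialPart_mem (hA : ConditionA π p) (hQ : QuiverIsAcyclic Q)
    (hπ : Function.Surjective π) {i j : Q} (ε : i ⟶ j) (k : Q) :
    pathClass π ε.toPath * initialPart π p k ∈
      Submodule.span K (Set.range (initialPart π p)) ⊔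
        leftTimes K (Ring.jacobson Λ) (pathClass π p) := by
  by_cases hki : i = k
  swap
  · rw [← pathClass_mul_vertexIdem π ε.toPath, ← vertexIdem_mul_initialPart hQ, mul_assoc,
      ← mul_assoc (vertexIdem π i), vertexIdem_mul_of_ne π hki, zero_mul, mul_zero]
    exact zero_mem _
  subst hki
  by_cases hi : i ∈ p.vertices
  swap
  · rw [initialPart_of_notMem hi, mul_zero]
    exact zero_mem _
  obtain ⟨u, w, huw⟩ := mem_vertices_iff_exists_comp.1 hi
  rw [initialPart_eq hQ huw]
  by_cases hj : j ∈ p.vertices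
  · refine Submodule.mem_sup_left ?_
    rw [← pathClass_cons]
    by_cases hε : IsArrowOf ε p
    · obtain ⟨w', hw', -⟩ := hε.exists_eq_comp hQ huw
      rw [← initialPart_eq hQ hw']
      exact Submodule.subset_span ⟨j, rfl⟩
    · obtain ⟨u', w', huw'⟩ := mem_vertices_iff_exists_comp.1 hj
      refine Submodule.span_mono ?_ (hA.2 i j ε u w u' w' huw huw' hε)
      rw [Set.singleton_subset_iff, ← initialPart_eq hQ huw']
      exact ⟨j, rfl⟩
  · refine Submodule.mem_sup_right ?_
    -- An arrow leaving the end of `p` is not covered by `ConditionA`, but `J` contains it, so the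
    -- product lies in `Jp` anyway.
    by_cases hib : i = b
    · subst hib
      rw [← initialPart_eq hQ huw, initialPart_end hQ]
      exact mem_leftTimes.2 ⟨_, pathClass_mem_jacobson hQ hπ _ (hQ.ne_of_hom ε), rfl⟩
    · rw [← pathClass_cons]
      exact hA.1 i j ε u w huw hib hj

/-- `Λ e_a` is contained in (initial parts) + `Jp`; since `Jp` kills `x` and the initial parts give
a basis of `U`, an annihilator of `x` has no initial-part component. -/
theorem IsMastGenerator.exists_mul_pathClass_of_conditionA {x : U} (h : IsMastGenerator π p x)
    (hQ : QuiverIsAcyclic Q) (hπ : Function.Surjective π) (hA : ConditionA π p) (l : Λ)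
    (hl : l • x = 0) : ∃ l' : Λ, l * vertexIdem π a = l' * pathClass π p := by
  set G := Submodule.span K (Set.range (initialPart π p)) ⊔
    leftTimes K (Ring.jacobson Λ) (pathClass π p) with hG
  have hmem : l * vertexIdem π a ∈ G := by
    refine mul_vertexIdem_mem hπ G ?_ (fun i j ε g hg => ?_) l
    · rw [← initialPart_start (p := p) hQ]
      exact Submodule.mem_sup_left (Submodule.subset_span ⟨a, rfl⟩)
    · have hle : G ≤ G.comap (LinearMap.mulLeft K (pathClass π ε.toPath)) := by
        rw [hG]
        refine sup_le (Submodule.span_le.2 ?_) ?_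
        · rintro _ ⟨k, rfl⟩
          exact hA.pathClass_mul_initialPart_mem hQ hπ ε k
        · intro z hz
          obtain ⟨r, hr, rfl⟩ := mem_leftTimes.1 hz
          exact Submodule.mem_sup_right (mem_leftTimes.2
            ⟨_, (Ring.jacobson Λ).mul_mem_left _ hr, mul_assoc _ _ _⟩)
      exact hle hg
  obtain ⟨y, hy, z, hz, hyz⟩ := Submodule.mem_sup.1 hmem
  obtain ⟨c, rfl⟩ := (Submodule.mem_span_range_iff_exists_fun K).1 hy
  obtain ⟨r, hr, rfl⟩ := mem_leftTimes.1 hz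
  refine ⟨r, ?_⟩
  have h1 : ∑ i, c i • initialPart π p i • x = 0 := by
    have := congrArg (· • x) hyz
    simp only [add_smul, h.jacobson_mul_pathClass_smul hQ hπ hr, add_zero, mul_smul l,
      h.vertexIdem_smul, hl] at this
    rw [← this, Finset.sum_smul]
    exact Finset.sum_congr rfl fun i _ => (smul_assoc _ _ _).symm
  rw [← hyz, Finset.sum_eq_zero, zero_add]
  intro i _
  by_cases hi : i ∈ p.vertices
  · rw [h.eq_zero_of_sum_eq_zero hQ h1 hi, zero_smul]
  · rw [initialPart_of_notMem hi, smul_zero]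

theorem IsBasisModJSq.mul_ne_zero {R : Set Λ} {z : Λ} (hR : IsBasisModJSq K R z) {r : Λ}
    (hr : r ∈ R) : r * z ≠ 0 := by
  intro h0
  have h1 := LinearIndependent.ne_zero ⟨_, r, hr, rfl⟩ hR.1
  simp only [id, h0, map_zero, ne_eq, not_true] at h1

/-- Nakayama's lemma: generators of `Jz` modulo `J² z` generate `Jz` as a left module. -/
theorem IsBasisModJSq.mul_mem_span [IsNoetherianRing Λ] {R : Set Λ} {z : Λ}
    (hR : IsBasisModJSq K R z) {r : Λ} (hr : r ∈ Ring.jacobson Λ) :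
    r * z ∈ Submodule.span Λ ((· * z) '' R) := by
  set L := Submodule.span Λ ((· * z) '' R) with hL
  let N : Submodule Λ Λ := Submodule.map (LinearMap.toSpanSingleton Λ Λ z) (Ring.jacobson Λ)
  have hle : N ≤ L ⊔ Ring.jacobson Λ • N := by
    rintro _ ⟨s, hs, rfl⟩
    set q := (leftTimes K (Ring.jacobson Λ ^ 2) z).mkQ with hq
    have h1 : q (s * z) ∈ (L.restrictScalars K).map q := by
      have h2 : q (s * z) ∈ (leftTimes K (Ring.jacobson Λ) z).map q :=
        ⟨_, mem_leftTimes.2 ⟨s, hs, rfl⟩, rfl⟩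
      rw [hq, ← hR.2] at h2
      refine Submodule.span_le.2 ?_ h2
      rintro _ ⟨t, ht, rfl⟩
      exact ⟨t * z, Submodule.subset_span ⟨t, ht, rfl⟩, rfl⟩
    obtain ⟨y, hy, hyq⟩ := h1
    rw [← sub_eq_zero, ← map_sub, hq, Submodule.mkQ_apply, Submodule.Quotient.mk_eq_zero] at hyq
    obtain ⟨t, ht, hty⟩ := mem_leftTimes.1 hyq
    have h3 : t * z ∈ Ring.jacobson Λ • N := by
      rw [Submodule.pow_succ, Submodule.pow_one] at ht
      refine Submodule.mul_induction_on ht (fun i hi j hj => ?_) (fun i j hi hj => ?_)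
      · rw [mul_assoc]
        exact Submodule.smul_mem_smul hi ⟨j, hj, rfl⟩
      · rw [add_mul]
        exact add_mem hi hj
    have h4 : s * z = y - t * z := by rw [hty, sub_sub_cancel]
    change s * z ∈ _
    rw [h4]
    exact sub_mem (Submodule.mem_sup_left hy) (Submodule.mem_sup_right h3)
  have hbot : N.map L.mkQ = ⊥ := by
    refine Submodule.FG.eq_bot_of_le_jacobson_smul ((IsNoetherian.noetherian N).map _) ?_
    have := Submodule.map_mono (f := L.mkQ) hle
    rwa [Submodule.map_sup, Submodule.mkQ_map_self, bot_sup_eq, Submodule.map_smul''] at this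
  have h5 : N ≤ L := by
    rw [← L.ker_mkQ]
    exact LinearMap.le_ker_iff_map.2 hbot
  exact h5 ⟨r, hr, rfl⟩

/-- The `K`-linear map sending `τ` to the family of all `r * τ`, `r ∈ R`. -/
def familyMul (K : Type*) [Field K] {Λ : Type*} [Ring Λ] [Algebra K Λ] (R : Set Λ) :
    Λ →ₗ[K] R → Λ :=
  LinearMap.pi fun r => LinearMap.mulLeft K r.1

theorem familyMul_eq_iff {R : Set Λ} {y z : Λ} :
    familyMul K R y = familyMul K R z ↔ ∀ r ∈ R, r * y = r * z :=
  ⟨fun h r hr => congrFun h ⟨r, hr⟩, fun h => funext fun r => h r.1 r.2⟩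

theorem terminalPart_mul_pathClass_mem (hQ : QuiverIsAcyclic Q)
    (hπ : Function.Surjective π) (hA : ConditionA π p) {R : Set Λ}
    (hR0 : ∀ r ∈ R, r * pathClass π p ≠ 0)
    (hi : ∀ (i j : Q) (γ : i ⟶ j) (u' : Path a j) (w' : Path j b), p = u'.comp w' → j ≠ a →
      i ∉ p.vertices →
        ∃ w ∈ timesLeft K (pathClass π p) (Ring.jacobson Λ),
          ∀ r ∈ R, r * pathClass π (γ.toPath.comp w') = r * w)
    (hii : ∀ (i j : Q) (δ : i ⟶ j) (u : Path a i) (w : Path i b) (u' : Path a j) (w' : Path j b),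
      p = u.comp w → p = u'.comp w' → ¬ IsArrowOf δ p →
        ∀ r ∈ R, r * pathClass π (δ.toPath.comp w') ∈ Submodule.span K {r * pathClass π w})
    {i j : Q} (ε : i ⟶ j) (k : Q) :
    ∃ t ∈ Submodule.span K (Set.range (terminalPart π p)) ⊔
        timesLeft K (pathClass π p) (Ring.jacobson Λ),
      ∀ r ∈ R, r * t = r * (terminalPart π p k * pathClass π ε.toPath) := by
  by_cases hkj : k = j
  swap
  · refine ⟨0, zero_mem _, fun r _ => ?_⟩
    rw [← terminalPart_mul_vertexIdem hQ, mul_assoc _ (vertexIdem π k),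
      vertexIdem_mul_pathClass_of_ne _ _ hkj, mul_zero, mul_zero, mul_zero]
  subst hkj
  by_cases hk : k ∈ p.vertices
  swap
  · exact ⟨0, zero_mem _, fun r _ => by rw [terminalPart_of_notMem hk, zero_mul]⟩
  obtain ⟨u', w', huw'⟩ := mem_vertices_iff_exists_comp.1 hk
  rw [terminalPart_eq hQ huw']
  by_cases hiv : i ∈ p.vertices
  · obtain ⟨u, w, huw⟩ := mem_vertices_iff_exists_comp.1 hiv
    rw [pathClass_mul_pathClass]
    have hw : pathClass π w ∈ Submodule.span K (Set.range (terminalPart π p)) := by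
      rw [← terminalPart_eq hQ huw]
      exact Submodule.subset_span ⟨i, rfl⟩
    by_cases hε : IsArrowOf ε p
    · obtain ⟨w₀, h1, h2⟩ := hε.exists_eq_comp hQ huw
      obtain ⟨-, rfl⟩ := hQ.comp_eq_comp (huw'.symm.trans h1)
      rw [h2] at hw
      exact ⟨_, Submodule.mem_sup_left hw, fun r _ => rfl⟩
    · obtain ⟨c, hc⟩ := Submodule.mem_span_singleton.1 (hA.2 i k ε u w u' w' huw huw' hε)
      refine ⟨c • pathClass π w, Submodule.mem_sup_left (Submodule.smul_mem _ _ hw),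
        fun r hr => ?_⟩
      obtain ⟨d, hd⟩ := Submodule.mem_span_singleton.1 (hii i k ε u w u' w' huw huw' hε r hr)
      -- The scalar `d` from (ii) may depend on `r`. Multiplying by the initial part `u` identifies
      -- it with the scalar `c` of `ConditionA`, which is the same for all `r`.
      have h1 : d • (r * pathClass π p) = c • (r * pathClass π p) := by
        calc d • (r * pathClass π p) = d • (r * pathClass π w) * pathClass π u := by
              rw [smul_mul_assoc, mul_assoc, pathClass_mul_pathClass, ← huw]
          _ = r * (pathClass π w' * pathClass π (u.cons ε)) := by
              rw [hd, pathClass_cons, ← pathClass_mul_pathClass]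
              simp only [mul_assoc]
          _ = c • (r * pathClass π p) := by
              rw [← hc, mul_smul_comm, mul_smul_comm, pathClass_mul_pathClass, ← huw']
      rw [← sub_eq_zero, ← sub_smul, smul_eq_zero, sub_eq_zero] at h1
      rw [← hd, h1.resolve_right (hR0 r hr), mul_smul_comm]
  · by_cases hka : k = a
    · subst hka
      rw [← terminalPart_eq hQ huw', terminalPart_start hQ]
      exact ⟨_, Submodule.mem_sup_right (mem_timesLeft.2
        ⟨_, pathClass_mem_jacobson hQ hπ _ (hQ.ne_of_hom ε), rfl⟩), fun r _ => rfl⟩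
    · obtain ⟨w, hw, hw'⟩ := hi i k ε u' w' huw' hka hiv
      rw [pathClass_mul_pathClass]
      exact ⟨w, Submodule.mem_sup_right hw, fun r hr => (hw' r hr).symm⟩

theorem IsMastGenerator.exists_factorization_of_conditions {x : U} (h : IsMastGenerator π p x)
    (hQ : QuiverIsAcyclic Q) (hπ : Function.Surjective π) (hA : ConditionA π p) {R : Set Λ}
    (hR0 : ∀ r ∈ R, r * pathClass π p ≠ 0)
    (hi : ∀ (i j : Q) (γ : i ⟶ j) (u' : Path a j) (w' : Path j b), p = u'.comp w' → j ≠ a →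
      i ∉ p.vertices →
        ∃ w ∈ timesLeft K (pathClass π p) (Ring.jacobson Λ),
          ∀ r ∈ R, r * pathClass π (γ.toPath.comp w') = r * w)
    (hii : ∀ (i j : Q) (δ : i ⟶ j) (u : Path a i) (w : Path i b) (u' : Path a j) (w' : Path j b),
      p = u.comp w → p = u'.comp w' → ¬ IsArrowOf δ p →
        ∀ r ∈ R, r * pathClass π (δ.toPath.comp w') ∈ Submodule.span K {r * pathClass π w})
    (τ : Λ) (hτ : vertexIdem π b * τ = τ) (hτU : ∀ u : U, τ • u = 0) :
    ∃ w ∈ Ring.jacobson Λ, ∀ r ∈ R, r * τ = r * pathClass π p * w := by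
  set H := Submodule.span K (Set.range (terminalPart π p)) ⊔
    timesLeft K (pathClass π p) (Ring.jacobson Λ) with hH
  let G : Submodule K Λ := (H.map (familyMul K R)).comap (familyMul K R)
  have hG : ∀ g, g ∈ G ↔ ∃ t ∈ H, ∀ r ∈ R, r * t = r * g := fun g =>
    exists_congr fun t => and_congr_right fun _ => familyMul_eq_iff
  have hmem : τ ∈ G := by
    rw [← hτ]
    refine vertexIdem_mul_mem hπ G ?_ (fun i j ε g hg => ?_) τ
    · rw [← terminalPart_end (p := p) hQ]
      exact (hG _).2 ⟨_, Submodule.mem_sup_left (Submodule.subset_span ⟨b, rfl⟩), fun r _ => rfl⟩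
    · have hle : H ≤ G.comap (LinearMap.mulRight K (pathClass π ε.toPath)) := by
        rw [hH]
        refine sup_le (Submodule.span_le.2 ?_) ?_
        · rintro _ ⟨k, rfl⟩
          exact (hG _).2 (terminalPart_mul_pathClass_mem hQ hπ hA hR0 hi hii ε k)
        · intro z hz
          obtain ⟨w, hw, rfl⟩ := mem_timesLeft.1 hz
          exact (hG _).2 ⟨_, Submodule.mem_sup_right (mem_timesLeft.2
            ⟨_, Ideal.mul_mem_right (pathClass π ε.toPath) _ hw, rfl⟩), fun r _ => by
              rw [LinearMap.mulRight_apply, mul_assoc (pathClass π p)]⟩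
      obtain ⟨t, ht, htg⟩ := (hG g).1 hg
      obtain ⟨t', ht', htg'⟩ := (hG _).1 (hle ht)
      refine (hG _).2 ⟨t', ht', fun r hr => ?_⟩
      rw [htg' r hr, LinearMap.mulRight_apply, ← mul_assoc, htg r hr, mul_assoc]
  obtain ⟨t, ht, htτ⟩ := (hG τ).1 hmem
  obtain ⟨y, hy, z, hz, rfl⟩ := Submodule.mem_sup.1 ht
  obtain ⟨c, rfl⟩ := (Submodule.mem_span_range_iff_exists_fun K).1 hy
  obtain ⟨w, hw, rfl⟩ := mem_timesLeft.1 hz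
  refine ⟨w, hw, fun r hr => ?_⟩
  rw [← htτ r hr, mul_add, ← mul_assoc, Finset.sum_eq_zero, mul_zero, zero_add]
  intro k _
  by_cases hk : k ∈ p.vertices
  -- Right multiplication by the initial part at `k` isolates the coefficient `c k`, since `pJ`
  -- kills it; (A') makes the same product with `τ` vanish.
  · have h1 : τ * initialPart π p k = 0 := by
      rw [← initialPart_mul_vertexIdem hQ, ← mul_assoc]
      refine h.mul_vertexIdem_eq_zero hQ hπ
        (h.exists_mul_pathClass_of_conditionA hQ hπ hA) ?_ ?_
      · rw [← mul_assoc, hτ]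
      · rw [mul_smul, hτU]
    have h2 : (∑ i, c i • terminalPart π p i + pathClass π p * w) * initialPart π p k =
        c k • pathClass π p := by
      rw [add_mul, pathClass_mul_mul_initialPart hQ hπ hw, add_zero, Finset.sum_mul,
        Finset.sum_eq_single k]
      · rw [smul_mul_assoc, terminalPart_mul_initialPart hQ hk]
      · intro i _ hik
        rw [smul_mul_assoc, terminalPart_mul_initialPart_of_ne hQ hik, smul_zero]
      · exact fun h => absurd (Finset.mem_univ k) h
    have h3 : c k • (r * pathClass π p) = 0 := by
      rw [← mul_smul_comm, ← h2, ← mul_assoc, htτ r hr, mul_assoc, h1, mul_zero]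
    rw [(smul_eq_zero.1 h3).resolve_right (hR0 r hr), zero_smul]
  · rw [terminalPart_of_notMem hk, smul_zero]

theorem IsMastGenerator.conditionA {x : U} (h : IsMastGenerator π p x) (hQ : QuiverIsAcyclic Q)
    (hπ : Function.Surjective π)
    (hA : ∀ l : Λ, l • x = 0 → ∃ l' : Λ, l * vertexIdem π a = l' * pathClass π p) :
    ConditionA π p := by
  constructor
  · intro i j β u w huw hib hj
    obtain ⟨l', hl'⟩ := hA (pathClass π (u.cons β)) (by
      rw [← vertexIdem_mul_pathClass, mul_smul, h.vertexIdem_smul_of_notMem hQ hj])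
    refine mem_leftTimes.2 ⟨vertexIdem π j * l' * vertexIdem π b,
      vertexIdem_mul_mul_vertexIdem_mem_jacobson hQ hπ ?_ l', ?_⟩
    · rintro rfl
      exact hj (Path.end_mem_vertices p)
    · rw [mul_assoc, vertexIdem_mul_pathClass, mul_assoc, ← hl', pathClass_mul_vertexIdem,
        vertexIdem_mul_pathClass]
  · intro i j δ u w u' w' huw huw' hδ
    obtain ⟨c, hc⟩ := h.vertexIdem_smul_eq hQ j (pathClass π (u.cons δ) • x)
    rw [← mul_smul, vertexIdem_mul_pathClass, initialPart_eq hQ huw'] at hc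
    obtain ⟨l', hl'⟩ := hA (pathClass π (u.cons δ) - c • pathClass π u') (by
      rw [sub_smul, smul_assoc, hc, sub_self])
    rw [sub_mul, smul_mul_assoc, pathClass_mul_vertexIdem, pathClass_mul_vertexIdem] at hl'
    have h1 : pathClass π (u.cons δ) - c • pathClass π u' =
        vertexIdem π j * l' * vertexIdem π b * pathClass π p := by
      rw [mul_assoc, vertexIdem_mul_pathClass, mul_assoc, ← hl', mul_sub, mul_smul_comm,
        vertexIdem_mul_pathClass, vertexIdem_mul_pathClass]
    rw [sub_eq_iff_eq_add] at h1
    rw [h1]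
    refine add_mem ?_ (Submodule.smul_mem _ _ (Submodule.mem_span_singleton_self _))
    -- The error term lies in `e_j Λ e_b p`: a multiple of `p` if `j = b`, and zero otherwise,
    -- because `p` already runs from `j` to `b`.
    by_cases hjb : j = b
    · subst hjb
      obtain ⟨d, hd⟩ := vertexIdem_mul_mul_vertexIdem_eq_smul hQ hπ j l'
      rw [hd, smul_mul_assoc, vertexIdem_mul_pathClass, ← initialPart_end (p := p) hQ,
        initialPart_eq hQ huw']
      exact Submodule.smul_mem _ _ (Submodule.mem_span_singleton_self _)
    · rw [vertexIdem_mul_mul_vertexIdem_eq_zero hQ hπ w' hjb, zero_mul]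
      exact zero_mem _

theorem exists_isBasisModJSq {R : Set Λ} (hR : R ⊆ (Ring.jacobson Λ : Set Λ)) {z : Λ}
    (h : ∀ r ∈ Ring.jacobson Λ, ∃ l ∈ R, l * z = r * z) :
    ∃ R' ⊆ R, IsBasisModJSq K R' z := by
  set q := (leftTimes K (Ring.jacobson Λ ^ 2) z).mkQ with hq
  obtain ⟨S, hS, hspan, hind⟩ := exists_linearIndependent K ((fun l => q (l * z)) '' R)
  have hset : {y | ∃ r ∈ {l ∈ R | q (l * z) ∈ S}, y = q (r * z)} = S := by
    ext y
    constructor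
    · rintro ⟨r, hr, rfl⟩
      exact hr.2
    · intro hy
      obtain ⟨l, hl, rfl⟩ := hS hy
      exact ⟨l, ⟨hl, hy⟩, rfl⟩
  refine ⟨{l ∈ R | q (l * z) ∈ S}, fun l hl => hl.1, ?_, ?_⟩
  · rw [hset]
    exact hind
  · rw [hset, hspan]
    refine le_antisymm (Submodule.span_le.2 ?_) ?_
    · rintro _ ⟨l, hl, rfl⟩
      exact ⟨l * z, mem_leftTimes.2 ⟨l, hR hl, rfl⟩, rfl⟩
    · rintro _ ⟨y, hy, rfl⟩
      obtain ⟨r, hr, rfl⟩ := mem_leftTimes.1 hy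
      obtain ⟨l, hl, hlr⟩ := h r hr
      rw [← hlr]
      exact Submodule.subset_span ⟨l, hl, rfl⟩

theorem IsMastGenerator.conditionB {x : U} (h : IsMastGenerator π p x) (hQ : QuiverIsAcyclic Q)
    (hπ : Function.Surjective π) {R : Set Λ} (hRJ : R ⊆ (Ring.jacobson Λ : Set Λ))
    (hR : ∀ r ∈ Ring.jacobson Λ, ∃ l ∈ R, l * pathClass π p = r * pathClass π p)
    (hB : ∀ τ : Λ, vertexIdem π b * τ = τ → (∀ u : U, τ • u = 0) →
      ∃ w ∈ Ring.jacobson Λ, ∀ r ∈ R, r * τ = r * pathClass π p * w) :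
    ConditionB π p := by
  obtain ⟨R', hR', hbasis⟩ := exists_isBasisModJSq (K := K) hRJ hR
  refine ⟨R', hR'.trans hRJ, hbasis, ?_, ?_⟩
  · intro i j γ u' w' huw' hja hi
    obtain ⟨w, hw, hw'⟩ := hB (pathClass π (γ.toPath.comp w')) (vertexIdem_mul_pathClass π _)
      (fun u => by
        rw [← pathClass_mul_vertexIdem, mul_smul, h.vertexIdem_smul_of_notMem hQ hi, smul_zero])
    exact ⟨_, mem_timesLeft.2 ⟨w, hw, rfl⟩, fun r hr => by rw [hw' r (hR' hr), mul_assoc]⟩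
  · intro i j δ u w u' w' huw huw' hδ r hr
    obtain ⟨c, hc⟩ := h.vertexIdem_smul_eq hQ b
      (pathClass π (δ.toPath.comp w') • initialPart π p i • x)
    rw [← mul_smul, vertexIdem_mul_pathClass, initialPart_end hQ] at hc
    set τ := pathClass π (δ.toPath.comp w') - c • pathClass π w with hτ
    have hτi : τ * vertexIdem π i = τ := by
      rw [hτ, sub_mul, smul_mul_assoc, pathClass_mul_vertexIdem, pathClass_mul_vertexIdem]
    obtain ⟨v, hv, hv'⟩ := hB τ
      (by rw [hτ, mul_sub, mul_smul_comm, vertexIdem_mul_pathClass, vertexIdem_mul_pathClass])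
      (fun y => by
        obtain ⟨d, hd⟩ := h.vertexIdem_smul_eq hQ i y
        rw [← hτi, mul_smul, hd, smul_comm, hτ, sub_smul, hc, smul_assoc, ← mul_smul,
          ← terminalPart_eq hQ huw, terminalPart_mul_initialPart hQ
            (mem_vertices_iff_exists_comp.2 ⟨u, w, huw⟩), sub_self, smul_zero])
    -- `rτ = rpv` with `v ∈ J`, and `e_a v e_i = 0` because `i` lies on `p`.
    have h1 : r * τ = 0 := by
      rw [← hτi, ← mul_assoc, hv' r (hR' hr), ← pathClass_mul_vertexIdem,
        mul_assoc, mul_assoc, mul_assoc, ← mul_assoc (vertexIdem π a),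
        vertexIdem_mul_mul_vertexIdem_eq_zero_of_mem_jacobson hQ hπ u hv, mul_zero, mul_zero]
    rw [hτ, mul_sub, sub_eq_zero, mul_smul_comm] at h1
    rw [h1]
    exact Submodule.smul_mem _ _ (Submodule.mem_span_singleton_self _)

end Conditions

/-! ### The equivalence. -/

theorem mainTheorem9 {K : Type*} [Field K] {Q : Type*} [Quiver Q] [Fintype Q]
    [∀ a b : Q, Finite (a ⟶ b)] (hQ : QuiverIsAcyclic Q)
    {Λ : Type*} [Ring Λ] [Algebra K Λ] (π : PathAlgebra K Q →ₐ[K] Λ)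
    (hπ : IsAdmissiblePresentation π) (hΛ : IsLeftMultiserial Λ)
    {U : Type*} [AddCommGroup U] [Module Λ U] [Module.Finite Λ U] (hU : IsUniserial Λ U)
    {a b : Q} (p : Path a b) (hp : IsMast π p U) :
    IsIrreducibleMap (radicalSubmodule Λ U).subtype ↔
      ¬ IsSimpleModule Λ U ∧ ConditionA π p ∧ ConditionB π p := by
  let _ : Module K U := Module.compHom U (algebraMap K Λ)
  have : IsScalarTower K Λ U := IsScalarTower.of_algebraMap_smul fun _ _ => rfl
  have hs := hπ.1
  obtain ⟨x, hx⟩ := hp.exists_isMastGenerator (K := K) hQ hs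
  have hab : ¬ IsSimpleModule Λ U → a ≠ b := by
    rintro hU rfl
    refine hU (Module.length_eq_one_iff.1 ?_)
    rw [hp.1, hQ a p]
    rfl
  constructor
  · intro hirr
    have hns : ¬ IsSimpleModule Λ U := by
      intro hsimple
      -- For simple `U` the radical is zero, so the inclusion would be a split monomorphism.
      have hbot : radicalSubmodule Λ U = ⊥ := (eq_bot_or_eq_top _).resolve_right fun htop =>
        hx.notMem_radicalSubmodule hQ hs (htop ▸ Submodule.mem_top)
      refine hirr.1 ⟨0, LinearMap.ext fun z => Subtype.ext ?_⟩
      exact (((Submodule.mem_bot Λ).1 (hbot ▸ z.2))).symm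
    obtain ⟨hA, R, hRJ, hR, hB⟩ := hx.exists_set_of_isIrreducibleMap hQ hπ (hab hns) hirr
    exact ⟨hns, hx.conditionA hQ hs hA, hx.conditionB hQ hs hRJ hR hB⟩
  · rintro ⟨hns, hA, R, hRJ, hR, hi, hii⟩
    have := hπ.isNoetherianRing
    exact hx.isIrreducibleMap hQ hs (hab hns) (hx.exists_mul_pathClass_of_conditionA hQ hs hA)
      (fun r hr => hR.mul_mem_span hr)
      (hx.exists_factorization_of_conditions hQ hs hA (fun r hr => hR.mul_ne_zero hr) hi hii)
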